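/- An instance of \textsc{Fair Hitting Set} is a tuple $\mathcal{I}=(\mathcal{U},\mathcal{F},\mathcal{B},f,k)$, where $\mathcal{U}$ is a finite universe, $\mathcal{F}=\{F_1,\dots,F_m\}$ and $\mathcal{B}=\{B_1,\dots,B_\ell\}$ are finite families of subsets of $\mathcal{U}$, $f:\mathcal{B}\to\mathbb{N}$, and $k$ is a positive integer. It is a yes-instance if there is $S\subseteq\mathcal{U}$ with $|S|\le k$, with $S\cap F_i\neq\emptyset$ for every $F_i\in\mathcal{F}$, and with $|S\cap B_j|\le f(B_j)$ for every $B_j\in\mathcal{B}$. Let $|\mathcal{I}|$ be the size of $\mathcal{I}$ (all numbers being written in binary), and let $G_{\mathcal{U},\mathcal{B}}$ be the bipartite incidence graph on $\mathcal{U}\uplus\mathcal{B}$, in which $u\in\mathcal{U}$ and $B_j\in\mathcal{B}$ are adjacent iff $u\in B_j$. A tree decomposition of a graph $G$ is a pair $(T,\beta)$ of a finite tree $T$ and a map $\beta:V(T)\to 2^{V(G)}$ such that the bags $\beta(t)$ cover $V(G)$, every edge of $G$ is contained in some bag, and for every $v\in V(G)$ the set $\{t: v\in\beta(t)\}$ induces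 a connected subtree of $T$. Its width is $\max_t|\beta(t)|-1$ (read as $0$ if all bags are empty). It is nice if $T$ is rooted at a node $r$ with $\beta(r)=\emptyset$, and every non-leaf node $t$ either has exactly one child $t'$, with $\beta(t)=\beta(t')\cup\{v\}$ for some $v\notin\beta(t')$ or $\beta(t)=\beta(t')\setminus\{w\}$ for some $w\in\beta(t')$, or has exactly two children $t_1,t_2$, with $\beta(t)=\beta(t_1)=\beta(t_2)$. Theorem. There is an algorithm that, given an instance $\mathcal{I}=(\mathcal{U},\mathcal{F},\mathcal{B},f,k)$ of \textsc{Fair Hitting Set} and a nice tree decomposition $(T,\beta)$ of $G_{\mathcal{U},\mathcal{B}}$ of width $\mathtt{tw}$, decides whether $\mathcal{I}$ is a yes-instance in time $$k^{\mathcal{O}(\mathtt{tw})}\cdot 2^{\mathcal{O}(|\mathcal{F}|)}\cdot(|\mathcal{I}|+|V(T)|)^{\mathcal{O}(1)}.$$ In particular the time is $k^{\mathcal{O}(\mathtt{tw})}\cdot 2^{\mathcal{O}(|\mathcal{F}|)}\cdot|\mathcal{I}|^{\mathcal{O}(1)}$ whenever, as usual, the given decomposition has $|\mathcal{I}|^{\mathcal{O}(1)}$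 nodes. -/

import Mathlib

namespace FairHS

/-! ## The machine model

First-order recursive programs over binary trees (pure first-order Lisp), with unit cost for every
evaluation step.  A step creates at most one cell, binds at most two variables or enters one
function body, and it only moves pointers: there is no arithmetic and no equality test on trees.
A random access machine simulates each step of a fixed program in constantly many operations. -/

/-- The data: binary trees, built from `nil` by pairing. -/
inductive Val : Type
  | nil : Val
  | cons : Val → Val → Val

/-- Expressions; variables are de Bruijn indices into the environment. -/
inductive Exp : Type
  /-- the value of a variable -/
  | var (i : ℕ) : Exp
  /-- the constant `nil` -/
  | nil : Exp
  /-- allocate a pair -/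
  | cons (a b : Exp) : Exp
  /-- if `e` is `nil` continue with `a`; if `e` is a pair, push its two components (head at
  index 0, tail at index 1) and continue with `b` -/
  | split (e a b : Exp) : Exp
  /-- push the value of `a` (at index 0) and continue with `b` -/
  | bind (a b : Exp) : Exp
  /-- call function number `g` of the program with one argument -/
  | call (g : ℕ) (a : Exp) : Exp

/-- A program: finitely many (mutually recursive) unary functions, given by their bodies, and a
main expression. -/
structure Program where
  funs : List Exp
  main : Exp

/-- `Eval D env e v t`: with function bodies `D` and in the environment `env`, the evaluation of
`e` (call by value) terminates with value `v` after exactly `t` steps. -/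
inductive Eval (D : List Exp) : List Val → Exp → Val → ℕ → Prop
  | var {env : List Val} {i : ℕ} {v : Val} : env[i]? = some v → Eval D env (.var i) v 1
  | nil {env : List Val} : Eval D env .nil .nil 1
  | cons {env : List Val} {a b : Exp} {x y : Val} {s t : ℕ} :
      Eval D env a x s → Eval D env b y t → Eval D env (.cons a b) (.cons x y) (s + t + 1)
  | splitNil {env : List Val} {e a b : Exp} {v : Val} {s t : ℕ} :
      Eval D env e .nil s → Eval D env a v t → Eval D env (.split e a b) v (s + t + 1)
  | splitCons {env : List Val} {e a b : Exp} {x y v : Val} {s t : ℕ} :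
      Eval D env e (.cons x y) s → Eval D (x :: y :: env) b v t →
      Eval D env (.split e a b) v (s + t + 1)
  | bind {env : List Val} {a b : Exp} {x v : Val} {s t : ℕ} :
      Eval D env a x s → Eval D (x :: env) b v t → Eval D env (.bind a b) v (s + t + 1)
  | call {env : List Val} {g : ℕ} {a body : Exp} {x v : Val} {s t : ℕ} :
      D[g]? = some body → Eval D env a x s → Eval D [x] body v t →
      Eval D env (.call g a) v (s + t + 1)

/-- Evaluation is deterministic: value and running time are determined by program and input. -/
theorem Eval.deterministic {D : List Exp} {env : List Val} {e : Exp} {v w : Val} {s t : ℕ}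
    (h : Eval D env e v s) (h' : Eval D env e w t) : v = w ∧ s = t := by
  induction h generalizing w t with
  | var h₁ => cases h' with | var h₂ => simp_all
  | nil => cases h'; simp
  | cons _ _ iha ihb =>
    cases h' with | cons ha hb => obtain ⟨rfl, rfl⟩ := iha ha; obtain ⟨rfl, rfl⟩ := ihb hb; simp
  | splitNil _ _ iha ihb =>
    cases h' with
    | splitNil ha hb => obtain ⟨_, rfl⟩ := iha ha; obtain ⟨rfl, rfl⟩ := ihb hb; simp
    | splitCons ha hb => exact absurd (iha ha).1 (by simp)
  | splitCons _ _ iha ihb =>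
    cases h' with
    | splitNil ha hb => exact absurd (iha ha).1 (by simp)
    | splitCons ha hb =>
      obtain ⟨h₁, rfl⟩ := iha ha
      obtain ⟨rfl, rfl⟩ := Val.cons.inj h₁
      obtain ⟨rfl, rfl⟩ := ihb hb
      simp
  | bind _ _ iha ihb =>
    cases h' with | bind ha hb => obtain ⟨rfl, rfl⟩ := iha ha; obtain ⟨rfl, rfl⟩ := ihb hb; simp
  | call hg _ _ iha ihb =>
    cases h' with
    | call hg' ha hb =>
      obtain ⟨rfl, rfl⟩ := iha ha
      obtain rfl := Option.some.inj (hg.symm.trans hg')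
      obtain ⟨rfl, rfl⟩ := ihb hb
      simp

/-- On input `x` the program `P` halts with output `v` after exactly `t` steps. -/
def Program.Runs (P : Program) (x v : Val) (t : ℕ) : Prop :=
  Eval P.funs [x] P.main v t

/-! ## Encodings -/

/-- A bit: `nil` for false, the pair of two `nil`s for true. -/
def Val.ofBool : Bool → Val
  | false => .nil
  | true => .cons .nil .nil

/-- A list, in the usual Lisp representation. -/
def Val.ofList : List Val → Val
  | [] => .nil
  | x :: l => .cons x (Val.ofList l)

/-- A natural number, as the list of its binary digits, least significant first. -/
def Val.ofNat (n : ℕ) : Val := Val.ofList (n.bits.map Val.ofBool)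

/-- A subset of `Fin n`, as its characteristic 0/1 vector of length `n`. -/
def Val.ofFinset {n : ℕ} (s : Finset (Fin n)) : Val :=
  Val.ofList (List.ofFn fun i => Val.ofBool (decide (i ∈ s)))

/-- A subset of `Fin n ⊕ Fin l`, as the pair of the characteristic vectors of its two parts. -/
def Val.ofBag {n l : ℕ} (s : Finset (Fin n ⊕ Fin l)) : Val :=
  .cons (Val.ofList (List.ofFn fun i => Val.ofBool (decide (Sum.inl i ∈ s))))
    (Val.ofList (List.ofFn fun j => Val.ofBool (decide (Sum.inr j ∈ s))))

/-! ## Fair Hitting Set -/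

/-- An instance `(U, F, B, f, k)`, with `U = {u_1, …, u_n}`, `F = {F_1, …, F_m}`,
`B = {B_1, …, B_l}` (repetitions among the listed sets are allowed) and `f (B_j) = cap j`. -/
structure Instance where
  n : ℕ
  m : ℕ
  l : ℕ
  F : Fin m → Finset (Fin n)
  B : Fin l → Finset (Fin n)
  cap : Fin l → ℕ
  k : ℕ
  k_pos : 0 < k

namespace Instance

/-- `S` is a fair hitting set: it has at most `k` elements, meets every `F_i`, and has at most
`f (B_j)` elements in every `B_j`. -/
def IsFairHittingSet (I : Instance) (S : Finset (Fin I.n)) : Prop :=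
  S.card ≤ I.k ∧ (∀ i, (S ∩ I.F i).Nonempty) ∧ ∀ j, (S ∩ I.B j).card ≤ I.cap j

/-- `I` is a yes-instance. -/
def IsYes (I : Instance) : Prop := ∃ S, I.IsFairHittingSet S

/-- The size of an instance: one unit per element of the universe, per set, per member of each
set, and per binary digit of the numbers `f (B_j)` and `k`. -/
def size (I : Instance) : ℕ :=
  I.n + (∑ i, ((I.F i).card + 1)) + (∑ j, ((I.B j).card + 1 + (I.cap j).size)) + I.k.size

/-- The bipartite incidence graph of `(U, B)`, on the disjoint union of `U` and `B`. -/
def incidenceGraph (I : Instance) : SimpleGraph (Fin I.n ⊕ Fin I.l) :=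
  SimpleGraph.fromRel fun x y => ∃ u j, x = Sum.inl u ∧ y = Sum.inr j ∧ u ∈ I.B j

/-- The list of `n`, the sets `F_i`, the pairs `(B_j, f (B_j))`, and `k`. -/
def encode (I : Instance) : Val :=
  Val.ofList
    [Val.ofNat I.n,
      Val.ofList (List.ofFn fun i => Val.ofFinset (I.F i)),
      Val.ofList (List.ofFn fun j => Val.cons (Val.ofFinset (I.B j)) (Val.ofNat (I.cap j))),
      Val.ofNat I.k]

end Instance

/-! ## Nice tree decompositions -/

/-- `(T, β)` is a tree decomposition of `G`. -/
structure IsTreeDecomposition {V N : Type*} (G : SimpleGraph V) (T : SimpleGraph N)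
    (β : N → Finset V) : Prop where
  isTree : T.IsTree
  cover : ∀ v, ∃ x, v ∈ β x
  edge : ∀ u v, G.Adj u v → ∃ x, u ∈ β x ∧ v ∈ β x
  connected : ∀ v, (T.induce {x | v ∈ β x}).Connected

/-- Finite rooted trees whose nodes carry bags (finite sets of vertices) and have no child, one
child, or two children. -/
inductive BagTree (V : Type*) : Type _
  | leaf (bag : Finset V) : BagTree V
  | one (bag : Finset V) (child : BagTree V) : BagTree V
  | two (bag : Finset V) (left right : BagTree V) : BagTree V

namespace BagTree

variable {V : Type*}

/-- The bag of the root. -/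
def rootBag : BagTree V → Finset V
  | leaf b => b
  | one b _ => b
  | two b _ _ => b

/-- The subtree rooted at the node that is reached from the root along the address `p`: `false`
leads to the only or left child, `true` to the right child. -/
def subtree? : BagTree V → List Bool → Option (BagTree V)
  | t, [] => some t
  | one _ t, false :: p => t.subtree? p
  | two _ l _, false :: p => l.subtree? p
  | two _ _ r, true :: p => r.subtree? p
  | _, _ => none

/-- The nodes, identified with their addresses. -/
abbrev Node (t : BagTree V) : Type := {p : List Bool // (t.subtree? p).isSome}

/-- The bag of a node. -/
def bag (t : BagTree V) (x : t.Node) : Finset V := ((t.subtree? x.1).get x.2).rootBag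

/-- The underlying graph: every node is joined to its children. -/
def graph (t : BagTree V) : SimpleGraph t.Node :=
  SimpleGraph.fromRel fun x y => ∃ b, y.1 = x.1 ++ [b]

/-- The number of nodes. -/
def numNodes : BagTree V → ℕ
  | leaf _ => 1
  | one _ t => t.numNodes + 1
  | two _ l r => l.numNodes + r.numNodes + 1

/-- The largest size of a bag. -/
def maxBagCard : BagTree V → ℕ
  | leaf b => b.card
  | one b t => max b.card t.maxBagCard
  | two b l r => max b.card (max l.maxBagCard r.maxBagCard)

/-- The width: the largest size of a bag, minus one (and 0 if all bags are empty). -/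
def width (t : BagTree V) : ℕ := t.maxBagCard - 1

/-- Every node with one child is an introduce node or a forget node, and every node with two
children is a join node. -/
def NodesNice [DecidableEq V] : BagTree V → Prop
  | leaf _ => True
  | one b t =>
    ((∃ v, v ∉ t.rootBag ∧ b = insert v t.rootBag) ∨ (∃ w ∈ t.rootBag, b = t.rootBag.erase w)) ∧
      t.NodesNice
  | two b l r => b = l.rootBag ∧ b = r.rootBag ∧ l.NodesNice ∧ r.NodesNice

/-- `t` is a nice tree decomposition of `G`. -/
def IsNiceTreeDecomposition [DecidableEq V] (G : SimpleGraph V) (t : BagTree V) : Prop :=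
  IsTreeDecomposition G t.graph t.bag ∧ t.rootBag = ∅ ∧ t.NodesNice

/-- A node is encoded as the list of its bag and its children. -/
def encode {n l : ℕ} : BagTree (Fin n ⊕ Fin l) → Val
  | leaf b => Val.ofList [Val.ofBag b]
  | one b t => Val.ofList [Val.ofBag b, t.encode]
  | two b t₁ t₂ => Val.ofList [Val.ofBag b, t₁.encode, t₂.encode]

end BagTree

end FairHS

/-! The algorithm is dynamic programming over the decomposition. The budget `|S| ≤ k` becomes one
more capacitated set, the whole universe with capacity `k`. It gets number `0` and is added to every
bag (`augBag`), so the connectivity conditions for it are trivial and only capacities remain.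

A partial solution `S` below a node with bag `b` is summarised by `sig b S`: the part of `S` inside
`b`, for each set of `b` the number of chosen elements already forgotten, and the family of the
`F_i` hit by forgotten elements. Since `b` separates the subtree from the rest, this is all that
later nodes need. Counting only forgotten elements makes the counts of two children additive at a
join. `mem_solve` says that the table of a node consists exactly of the states of valid partial
solutions. At the root the bag is empty, so the hit family of a state is all that `S` hits
(`isYes_iff`).

The separation facts follow from connectedness of the nodes containing a vertex: such a set can
leave a subtree only through the edge above it (`mem_of_connected`, `layered`).

For the running time, a table has at most `(k+1)^(w+2) * 2^m` states if `2 ≤ k`. For `k = 1` the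
factor `k^w` is useless, and one counts partial solutions instead (`length_le_of_sig`). Each table
is computed in time polynomial in the input size and the largest table (`polyBounded_cMain`); the
code is verified with exact values and cost bounds by a weakest-precondition calculus. -/

namespace FairHS

/-! ## Code -/

/-- Structural recursion over the list in the second component of the argument; the first
component is kept.  `consc` is run in an environment that starts with the recursive result, the
head, the tail and the first component. -/
def foldE (self : ℕ) (nilc consc : Exp) : Exp :=
  .split (.var 0) .nil
    (.split (.var 1) nilc (.bind (.call self (.cons (.var 2) (.var 1))) consc))

/-- Simultaneous recursion over two lists. -/
def zipE (self : ℕ) (nilc consc : Exp) : Exp :=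
  .split (.var 0) .nil
    (.split (.var 0) nilc
      (.split (.var 3) nilc
        (.bind (.call self (.cons (.var 3) (.var 1))) consc)))

def ttE : Exp := .cons .nil .nil

/-- Each number is the position of the body in `code`, so the lookup in a specification holds by
`rfl`. -/
abbrev fApp : ℕ := 0
abbrev fZipApp : ℕ := 1
abbrev fMask : ℕ := 2
abbrev fMinus : ℕ := 3
abbrev fCnt : ℕ := 4
abbrev fCnts : ℕ := 5
abbrev fTrunc : ℕ := 6
abbrev fHalf : ℕ := 7
abbrev fLeq : ℕ := 8
abbrev fAllLeq : ℕ := 9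
abbrev fVeq : ℕ := 10
abbrev fMem : ℕ := 11
abbrev fMapCons : ℕ := 12
abbrev fSingles : ℕ := 13
abbrev fAllTrue : ℕ := 14
abbrev fAnyFull : ℕ := 15
abbrev fFsts : ℕ := 16
abbrev fSnds : ℕ := 17
abbrev fUpd : ℕ := 18
abbrev fCheck : ℕ := 19
abbrev fIns : ℕ := 20
abbrev fStep : ℕ := 21
abbrev fLeaf : ℕ := 22
abbrev fJoinIn : ℕ := 23
abbrev fJoin : ℕ := 24
abbrev fSolve : ℕ := 25

def halfE : Exp :=
  .split (.var 0) .nil (.split (.var 1) ttE (.cons .nil (.call fHalf (.var 1))))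

/-- Argument: a unary number and a binary number. -/
def leqE : Exp :=
  .split (.var 0) .nil <| .split (.var 0) ttE <| .split (.var 3) .nil <|
    .split (.var 0) (.call fLeq (.cons (.call fHalf (.var 4)) (.var 1)))
      (.call fLeq (.cons (.call fHalf (.var 5)) (.var 3)))

def veqE : Exp :=
  .split (.var 0) .nil <|
    .split (.var 0) (.split (.var 1) ttE .nil) <|
      .split (.var 3) .nil <|
        .split (.call fVeq (.cons (.var 2) (.var 0))) .nil <|
          .call fVeq (.cons (.var 5) (.var 3))

/-- Argument `((F, (W, cap)), ((bU, bY), (x, (y, c))))`. -/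
def updE : Exp :=
  .split (.var 0) .nil <|
    .split (.var 0) .nil <|
      .split (.var 1) .nil <|
        .split (.var 5) .nil <|
          .split (.var 0) .nil <|
            .split (.var 3) .nil <|
              .split (.var 1) .nil <|
                -- y c x yc bU bY b s W cap F WC
                .bind (.call fMinus (.cons (.var 4) (.var 2))) <|
                  .cons (.call fMask (.cons (.var 5) (.var 3)))
                    (.cons
                      (.call fMask (.cons (.var 6)
                        (.call fZipApp (.cons (.var 1) (.call fCnts (.cons (.var 0) (.var 9)))))))
                      (.call fTrunc (.cons .nil
                        (.call fZipApp (.cons (.var 2)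
                          (.call fCnts (.cons (.var 0) (.var 11))))))))

/-- Argument as for `updE`. -/
def checkE : Exp :=
  .split (.var 0) .nil <|
    .split (.var 0) .nil <|
      .split (.var 1) .nil <|
        .split (.var 5) .nil <|
          .split (.var 0) .nil <|
            .split (.var 3) .nil <|
              .split (.var 1) .nil <|
                .call fAllLeq (.cons
                  (.call fMask (.cons (.var 5)
                    (.call fZipApp (.cons (.var 0) (.call fCnts (.cons (.var 2) (.var 8)))))))
                  (.var 9))

/-- Argument `(G, (b, (s, acc)))`. -/
def insE : Exp :=
  .split (.var 0) .nil <|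
    .split (.var 1) .nil <|
      .split (.var 1) .nil <|
        -- s acc b sa G bsa
        .split (.call fCheck (.cons (.var 4) (.cons (.var 2) (.var 0)))) (.var 1) <|
          .split (.call fMem (.cons (.var 2) (.var 3))) (.cons (.var 2) (.var 3)) (.var 5)

/-- Loop body over the table, with parameter `(G, (b, e))`. -/
def stepC : Exp :=
  .split (.var 3) .nil <|
    .split (.var 1) .nil <|
      .split (.var 5) .nil <|
        -- x yc b e G be r s
        .call fIns (.cons (.var 4) (.cons (.var 2) (.cons
          (.call fUpd (.cons (.var 4) (.cons (.var 2)
            (.cons (.call fTrunc (.cons .nil (.call fZipApp (.cons (.var 0) (.var 3)))))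
              (.var 1)))))
          (.call fIns (.cons (.var 4) (.cons (.var 2) (.cons
            (.call fUpd (.cons (.var 4) (.cons (.var 2) (.var 7))))
            (.var 6))))))))

/-- Initial table of a leaf, with parameter `((F, (W, cap)), (bU, bY))`. -/
def leafN : Exp :=
  .split (.var 0) .nil <|
    .split (.var 0) .nil <|
      .split (.var 1) .nil <|
        .split (.var 5) .nil <|
          -- bU bY W cap F WC
          .bind (.call fMinus (.cons (.var 0) (.var 0))) <|
            .cons
              (.cons (.var 0) (.cons (.call fCnts (.cons (.var 0) (.var 3)))
                (.call fCnts (.cons (.var 0) (.var 5)))))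
              .nil

def leafC : Exp :=
  .split (.var 3) .nil <|
    .call fStep (.cons (.cons (.var 0) (.cons (.var 1) (.var 3))) (.var 2))

/-- Parameter `(G, (b, (s₁, acc)))`. -/
def joinInN : Exp :=
  .split (.var 0) .nil <| .split (.var 1) .nil <| .split (.var 1) .nil (.var 1)

def joinInC : Exp :=
  .split (.var 3) .nil <|
    .split (.var 1) .nil <|
      .split (.var 1) .nil <|
        .split (.var 0) .nil <|
          .split (.var 1) .nil <|
            .split (.var 11) .nil <|
              .split (.var 1) .nil <|
                -- y₂ c₂ x₂ yc₂ y₁ c₁ x₁ yc₁ s₁ acc b sa G bsa r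
                .split (.call fVeq (.cons (.var 6) (.var 2))) (.var 14) <|
                  .call fIns (.cons (.var 14) (.cons (.var 12) (.cons
                    (.cons (.var 8) (.cons (.call fZipApp (.cons (.var 6) (.var 2)))
                      (.call fTrunc (.cons .nil (.call fZipApp (.cons (.var 7) (.var 3)))))))
                    (.var 16))))

/-- Parameter `(G, (b, T₂))`. -/
def joinC : Exp :=
  .split (.var 3) .nil <|
    .split (.var 1) .nil <|
      -- b T₂ G bT r s₁
      .call fJoinIn (.cons (.cons (.var 2) (.cons (.var 0) (.cons (.var 5) (.var 4)))) (.var 1))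

/-- Argument `(G, tree)`. -/
def solveE : Exp :=
  .split (.var 0) .nil <|
    .split (.var 1) .nil <|
      .split (.var 0) .nil <|
        -- The budget set has number `0`, so adding it to the bag is one `cons` of true in front of
        -- `bY`.
        .bind (.cons (.var 0) (.cons ttE (.var 1))) <|
          -- b bU bY bag ch G tree
          .split (.var 4) (.call fLeaf (.cons (.cons (.var 5) (.var 0))
              (.call fSingles (.cons .nil (.var 1))))) <|
            .bind (.call fSolve (.cons (.var 7) (.var 0))) <|
              -- T₁ t₁ ch₂ b bU bY bag ch G tree
              .split (.var 2)
                (.split (.var 1) .nil <|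
                  .split (.var 0) .nil <|
                    .call fStep (.cons
                      -- The bag of the node minus that of its child: the introduced element, or
                      -- nothing. Introduce and forget nodes thus run the same code.
                      (.cons (.var 12) (.cons (.var 7) (.call fMinus (.cons (.var 0) (.var 8)))))
                      (.var 4)))
                (.bind (.call fSolve (.cons (.var 10) (.var 0))) <|
                  -- T₂ t₂ _ T₁ t₁ ch₂ b bU bY bag ch G tree
                  .call fJoin (.cons (.cons (.var 11) (.cons (.var 6) (.var 0))) (.var 3)))

def code : List Exp :=
  [foldE fApp (.var 0) (.cons (.var 1) (.var 0)),
    zipE fZipApp .nil (.cons (.call fApp (.cons (.var 1) (.var 3))) (.var 0)),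
    zipE fMask .nil (.cons (.split (.var 3) .nil (.var 3)) (.var 0)),
    zipE fMinus .nil (.cons (.split (.var 3) (.var 1) .nil) (.var 0)),
    zipE fCnt .nil (.split (.var 3) (.var 0) (.split (.var 3) (.var 2) (.cons .nil (.var 4)))),
    foldE fCnts .nil (.cons (.call fCnt (.cons (.var 3) (.var 1))) (.var 0)),
    foldE fTrunc .nil (.cons (.split (.var 1) .nil ttE) (.var 0)),
    halfE,
    leqE,
    zipE fAllLeq ttE (.split (.call fLeq (.cons (.var 3) (.var 1))) .nil (.var 2)),
    veqE,
    foldE fMem .nil (.split (.call fVeq (.cons (.var 3) (.var 1))) (.var 0) ttE),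
    foldE fMapCons .nil (.cons (.cons (.var 3) (.var 1)) (.var 0)),
    foldE fSingles .nil (.cons (.cons (.var 1) (.call fMinus (.cons (.var 2) (.var 2))))
      (.call fMapCons (.cons .nil (.var 0)))),
    foldE fAllTrue ttE (.split (.var 1) .nil (.var 2)),
    foldE fAnyFull .nil (.split (.var 1) .nil <| .split (.var 1) .nil <|
      .split (.call fAllTrue (.cons .nil (.var 1))) (.var 4) ttE),
    foldE fFsts .nil (.cons (.split (.var 1) .nil (.var 0)) (.var 0)),
    foldE fSnds .nil (.cons (.split (.var 1) .nil (.var 1)) (.var 0)),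
    updE,
    checkE,
    insE,
    foldE fStep .nil stepC,
    foldE fLeaf leafN leafC,
    foldE fJoinIn joinInN joinInC,
    foldE fJoin .nil joinC,
    solveE]

/-- Argument `([n, F, BC, k], tree)`. -/
def mainE : Exp :=
  .split (.var 0) .nil <|
    .split (.var 0) .nil <|
      .split (.var 1) .nil <|
        .split (.var 1) .nil <|
          .split (.var 1) .nil <|
            -- k _ BC _ F _ _ _ I T
            .split (.var 9) .nil <|
              .split (.var 0) .nil <|
                -- bU _ _ _ k _ BC _ F _ _ _ I T
                .call fAnyFull (.cons .nil (.call fSolve (.cons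
                  (.cons (.var 8) (.cons
                    (.cons (.call fTrunc (.cons .nil (.call fMapCons (.cons .nil (.var 0)))))
                      (.call fFsts (.cons .nil (.var 6))))
                    (.cons (.var 4) (.call fSnds (.cons .nil (.var 6))))))
                  (.var 13))))

def program : Program := ⟨code, mainE⟩

/-! ## A calculus for evaluation -/

/-- A total-correctness weakest precondition. With the equivalences below, `simp` executes code
symbolically and stops at function calls, where the goal is an `FnP` to be supplied by the
specification of the callee. -/
def Wp (env : List Val) (e : Exp) (P : Val → ℕ → Prop) : Prop :=
  ∃ v t, Eval code env e v t ∧ P v t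

def FnP (g : ℕ) (x : Val) (P : Val → ℕ → Prop) : Prop :=
  ∃ body, code[g]? = some body ∧ Wp [x] body P

def Is (v : Val) (B : ℕ) : Val → ℕ → Prop := fun w t => w = v ∧ t ≤ B

/-- Function number `g` maps `x` to `v` within `B` steps. -/
def Fn (g : ℕ) (x v : Val) (B : ℕ) : Prop := FnP g x (Is v B)

def SplitP (x : Val) (A : Prop) (B : Val → Val → Prop) : Prop :=
  match x with
  | .nil => A
  | .cons y z => B y z

@[simp] theorem splitP_nil {A : Prop} {B : Val → Val → Prop} : SplitP .nil A B = A := rfl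
@[simp] theorem splitP_cons {x y : Val} {A : Prop} {B : Val → Val → Prop} :
    SplitP (.cons x y) A B = B x y := rfl

variable {env : List Val} {P Q : Val → ℕ → Prop}

@[simp] theorem wp_var_zero {x : Val} : Wp (x :: env) (.var 0) P ↔ P x 1 := by
  constructor
  · rintro ⟨v, t, h, hP⟩; cases h with | var h => simp_all
  · exact fun h => ⟨x, 1, .var rfl, h⟩

@[simp] theorem wp_var_succ {x : Val} {i : ℕ} :
    Wp (x :: env) (.var (i + 1)) P ↔ Wp env (.var i) P := by
  constructor
  · rintro ⟨v, t, h, hP⟩; cases h with | var h => exact ⟨v, 1, .var (by simpa using h), hP⟩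
  · rintro ⟨v, t, h, hP⟩; cases h with | var h => exact ⟨v, 1, .var (by simpa using h), hP⟩

@[simp] theorem wp_nil : Wp env .nil P ↔ P .nil 1 := by
  constructor
  · rintro ⟨v, t, h, hP⟩; cases h; exact hP
  · exact fun h => ⟨_, _, .nil, h⟩

@[simp] theorem wp_cons {a b : Exp} : Wp env (.cons a b) P ↔
    Wp env a fun x s => Wp env b fun y t => P (.cons x y) (s + t + 1) := by
  constructor
  · rintro ⟨v, t, h, hP⟩; cases h with | cons ha hb => exact ⟨_, _, ha, _, _, hb, hP⟩
  · rintro ⟨_, _, ha, _, _, hb, hP⟩; exact ⟨_, _, .cons ha hb, hP⟩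

@[simp] theorem wp_bind {a b : Exp} : Wp env (.bind a b) P ↔
    Wp env a fun x s => Wp (x :: env) b fun y t => P y (s + t + 1) := by
  constructor
  · rintro ⟨v, t, h, hP⟩; cases h with | bind ha hb => exact ⟨_, _, ha, _, _, hb, hP⟩
  · rintro ⟨_, _, ha, _, _, hb, hP⟩; exact ⟨_, _, .bind ha hb, hP⟩

@[simp] theorem wp_split {e a b : Exp} : Wp env (.split e a b) P ↔
    Wp env e fun x s => SplitP x (Wp env a fun v t => P v (s + t + 1))
      fun y z => Wp (y :: z :: env) b fun v t => P v (s + t + 1) := by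
  constructor
  · rintro ⟨v, t, h, hP⟩
    cases h with
    | splitNil ha hb => exact ⟨_, _, ha, _, _, hb, hP⟩
    | splitCons ha hb => exact ⟨_, _, ha, _, _, hb, hP⟩
  · rintro ⟨x, _, ha, h⟩
    cases x with
    | nil => obtain ⟨_, _, hb, hP⟩ := h; exact ⟨_, _, .splitNil ha hb, hP⟩
    | cons => obtain ⟨_, _, hb, hP⟩ := h; exact ⟨_, _, .splitCons ha hb, hP⟩

@[simp] theorem wp_call {g : ℕ} {a : Exp} : Wp env (.call g a) P ↔
    Wp env a fun x s => FnP g x fun v t => P v (s + t + 1) := by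
  constructor
  · rintro ⟨v, t, h, hP⟩
    cases h with | call hg ha hb => exact ⟨_, _, ha, _, hg, _, _, hb, hP⟩
  · rintro ⟨_, _, ha, _, hg, _, _, hb, hP⟩; exact ⟨_, _, .call hg ha hb, hP⟩

theorem Wp.mono {e : Exp} (h : Wp env e P) (hPQ : ∀ v t, P v t → Q v t) : Wp env e Q :=
  let ⟨v, t, he, hP⟩ := h
  ⟨v, t, he, hPQ v t hP⟩

theorem Fn.bind {g : ℕ} {x v : Val} {B : ℕ} (h : Fn g x v B) (hP : ∀ t, t ≤ B → P v t) :
    FnP g x P := by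
  obtain ⟨body, hb, h⟩ := h
  exact ⟨body, hb, h.mono fun _ t ⟨hw, ht⟩ => hw ▸ hP t ht⟩

theorem Fn.mono {g : ℕ} {x v : Val} {B B' : ℕ} (h : Fn g x v B) (hB : B ≤ B') : Fn g x v B' :=
  h.bind fun _ ht => ⟨rfl, ht.trans hB⟩

theorem Wp.bindIs {e : Exp} {v : Val} {B : ℕ} (h : Wp env e (Is v B))
    (hP : ∀ t, t ≤ B → P v t) : Wp env e P :=
  h.mono fun _ t ⟨hw, ht⟩ => hw ▸ hP t ht

theorem Fn.intro {g : ℕ} {x v : Val} {B : ℕ} (body : Exp) (hg : code[g]? = some body)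
    (h : Wp [x] body (Is v B)) : Fn g x v B := ⟨body, hg, h⟩

/-! ## Loops -/

theorem ofList_nil : Val.ofList [] = .nil := rfl
theorem ofList_cons (x : Val) (l : List Val) :
    Val.ofList (x :: l) = .cons x (Val.ofList l) := rfl

/-- Cost of at most `q` rounds of a loop with body cost `C` and exit cost `c`. -/
def loop (q C c : ℕ) : ℕ := q * (C + 12) + c + 12

theorem loop_mono {p q C c : ℕ} (h : p ≤ q) : loop p C c ≤ loop q C c := by
  unfold loop; gcongr

/-- Induction on the list. The loop body is specified only on suffixes of `l`, the lists actually
reached, so facts about `l` such as `Nodup` or a bound on all intermediate tables can be used in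
every round. -/
theorem foldE_spec {α : Type*} {g : ℕ} {nilc consc : Exp}
    (hg : code[g]? = some (foldE g nilc consc)) (enc : α → Val) (R : List α → Val) (p : Val)
    {c C q : ℕ} (l : List α) (hq : l.length ≤ q)
    (hnil : ∀ rest, Wp (p :: rest) nilc (Is (R []) c))
    (hcons : ∀ h t, h :: t <:+ l → ∀ rest,
      Wp (R t :: enc h :: Val.ofList (t.map enc) :: p :: rest) consc (Is (R (h :: t)) C)) :
    Fn g (.cons p (Val.ofList (l.map enc))) (R l) (loop q C c) := by
  refine Fn.mono ?_ (loop_mono hq)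
  clear hq
  induction l with
  | nil =>
    refine .intro _ hg ?_
    simp only [foldE, wp_split, wp_var_zero, wp_var_succ, splitP_cons, List.map_nil, ofList_nil,
      splitP_nil]
    refine (hnil _).bindIs fun t ht => ⟨rfl, ?_⟩
    simp only [loop]; omega
  | cons h l ih =>
    refine .intro _ hg ?_
    simp only [foldE, wp_split, wp_var_zero, wp_var_succ, splitP_cons, List.map_cons, ofList_cons,
      wp_bind, wp_call, wp_cons]
    refine (ih fun h' t ht => hcons h' t (ht.trans (List.suffix_cons _ _))).bind fun t₁ ht₁ => ?_
    refine (hcons h l List.suffix_rfl _).bindIs fun t₂ ht₂ => ⟨rfl, ?_⟩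
    simp only [loop, List.length_cons, Nat.add_mul] at ht₁ ⊢; omega

theorem zipE_spec {α : Type*} {g : ℕ} {nilc consc : Exp}
    (hg : code[g]? = some (zipE g nilc consc)) (enc enc' : α → Val) (R : List α → Val)
    {c C q : ℕ} (l : List α) (hq : l.length ≤ q)
    (hnil : ∀ env, Wp env nilc (Is (R []) c))
    (hcons : ∀ h t, h :: t <:+ l → ∀ rest,
      Wp (R t :: enc' h :: Val.ofList (t.map enc') :: enc h :: rest) consc (Is (R (h :: t)) C)) :
    Fn g (.cons (Val.ofList (l.map enc)) (Val.ofList (l.map enc'))) (R l) (loop q C c) := by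
  refine Fn.mono ?_ (loop_mono hq)
  clear hq
  induction l with
  | nil =>
    refine .intro _ hg ?_
    simp only [zipE, wp_split, wp_var_zero, wp_var_succ, splitP_cons, List.map_nil, ofList_nil,
      splitP_nil]
    refine (hnil _).bindIs fun t ht => ⟨rfl, ?_⟩
    simp only [loop]; omega
  | cons h l ih =>
    refine .intro _ hg ?_
    simp only [zipE, wp_split, wp_var_zero, wp_var_succ, splitP_cons, List.map_cons, ofList_cons,
      wp_bind, wp_call, wp_cons]
    refine (ih fun h' t ht => hcons h' t (ht.trans (List.suffix_cons _ _))).bind fun t₁ ht₁ => ?_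
    refine (hcons h l List.suffix_rfl _).bindIs fun t₂ ht₂ => ⟨rfl, ?_⟩
    simp only [loop, List.length_cons, Nat.add_mul] at ht₁ ⊢; omega

/-! ## Specifications of the arithmetic and vector functions -/

def unary (n : ℕ) : Val := Val.ofList (List.replicate n .nil)

theorem unary_zero : unary 0 = .nil := rfl
theorem unary_succ (n : ℕ) : unary (n + 1) = .cons .nil (unary n) := rfl
theorem ttE_wp {env : List Val} {P : Val → ℕ → Prop} : Wp env ttE P ↔ P (unary 1) 3 := by
  simp [ttE, unary_succ, unary_zero]

/-- Bits are unary numbers up to one, so characteristic vectors and vectors of counts share their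
code, with "nonzero" as membership. -/
theorem ofBool_eq_unary (b : Bool) : Val.ofBool b = unary b.toNat := by cases b <;> rfl

/-- The vector of the unary numbers `f i`, for `i` in `l`. -/
def lvec {α : Type*} (l : List α) (f : α → ℕ) : Val := Val.ofList (l.map fun i => unary (f i))

abbrev vec {n : ℕ} (f : Fin n → ℕ) : Val := lvec (List.finRange n) f

def cApp (q : ℕ) : ℕ := loop q 3 1

theorem app_spec (b : ℕ) {a q : ℕ} (hq : a ≤ q) :
    Fn fApp (.cons (unary b) (unary a)) (unary (a + b)) (cApp q) := by
  have := foldE_spec (g := fApp) (α := Unit) rfl (fun _ => Val.nil) (fun l => unary (l.length + b))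
    (unary b) (c := 1) (C := 3) (q := q) (List.replicate a ()) (by simpa) (by simp [Is])
    (by
      intro h t _ rest
      simp [Is, Nat.add_right_comm _ 1 b, unary_succ])
  simpa [unary, cApp] using this

def cZipApp (q : ℕ) : ℕ := loop q (cApp q + 10) 1

theorem zipApp_spec {α : Type*} {q : ℕ} (l : List α) (f g : α → ℕ) (hl : l.length ≤ q)
    (hq : ∀ i, f i ≤ q) :
    Fn fZipApp (.cons (lvec l f) (lvec l g)) (lvec l fun i => f i + g i) (cZipApp q) := by
  refine zipE_spec rfl _ _ (fun l => lvec l fun i => f i + g i) l hl (by simp [Is, lvec, ofList_nil])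
    fun h t _ rest => ?_
  simp only [wp_cons, wp_call, wp_var_zero, wp_var_succ]
  refine (app_spec _ (hq h)).bind fun t₁ ht => ?_
  exact ⟨rfl, by omega⟩

def cMask (q : ℕ) : ℕ := loop q 10 1

theorem mask_spec {α : Type*} {q : ℕ} (l : List α) (f g : α → ℕ) (hl : l.length ≤ q) :
    Fn fMask (.cons (lvec l f) (lvec l g)) (lvec l fun i => if f i = 0 then 0 else g i)
      (cMask q) := by
  refine zipE_spec rfl _ _ (fun l => lvec l fun i => if f i = 0 then 0 else g i) l hl
    (by simp [Is, lvec, ofList_nil]) fun h t _ rest => ?_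
  cases hf : f h <;> simp [Is, hf, unary_zero, unary_succ, lvec, ofList_cons]

def cMinus (q : ℕ) : ℕ := loop q 10 1

theorem minus_spec {α : Type*} {q : ℕ} (l : List α) (f g : α → ℕ) (hl : l.length ≤ q) :
    Fn fMinus (.cons (lvec l f) (lvec l g)) (lvec l fun i => if f i = 0 then g i else 0)
      (cMinus q) := by
  refine zipE_spec rfl _ _ (fun l => lvec l fun i => if f i = 0 then g i else 0) l hl
    (by simp [Is, lvec, ofList_nil]) fun h t _ rest => ?_
  cases hf : f h <;> simp [Is, hf, unary_zero, unary_succ, lvec, ofList_cons]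

def cCnt (q : ℕ) : ℕ := loop q 10 1

theorem cnt_spec {α : Type*} {q : ℕ} (l : List α) (f g : α → ℕ) (hl : l.length ≤ q) :
    Fn fCnt (.cons (lvec l f) (lvec l g)) (unary (l.countP fun i => f i ≠ 0 ∧ g i ≠ 0))
      (cCnt q) := by
  refine zipE_spec rfl _ _ (fun l => unary (l.countP fun i => f i ≠ 0 ∧ g i ≠ 0)) l hl
    (by simp [Is, unary_zero]) fun h t _ rest => ?_
  cases hf : f h <;> cases hg : g h <;>
    simp [Is, hf, hg, unary_zero, unary_succ]

def cCnts (q : ℕ) : ℕ := loop q (cCnt q + 10) 1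

theorem cnts_spec {α β : Type*} {q : ℕ} (l : List α) (l' : List β) (f : α → ℕ) (g : β → α → ℕ)
    (hl : l.length ≤ q) (hl' : l'.length ≤ q) :
    Fn fCnts (.cons (lvec l f) (Val.ofList (l'.map fun j => lvec l (g j))))
      (lvec l' fun j => l.countP fun i => f i ≠ 0 ∧ g j i ≠ 0) (cCnts q) := by
  refine foldE_spec rfl _ (fun l' => lvec l' fun j => l.countP fun i => f i ≠ 0 ∧ g j i ≠ 0) _ l'
    hl' (by simp [Is, lvec, ofList_nil]) fun h t _ rest => ?_
  simp only [wp_cons, wp_call, wp_var_zero, wp_var_succ]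
  refine (cnt_spec l _ _ hl).bind fun t₁ ht => ?_
  exact ⟨rfl, by omega⟩

def cTrunc (q : ℕ) : ℕ := loop q 10 1

theorem trunc_spec {α : Type*} {q : ℕ} (l : List α) (f : α → ℕ) (hl : l.length ≤ q) :
    Fn fTrunc (.cons .nil (lvec l f)) (lvec l fun i => if f i = 0 then 0 else 1) (cTrunc q) := by
  refine foldE_spec rfl _ (fun l => lvec l fun i => if f i = 0 then 0 else 1) _ l hl
    (by simp [Is, lvec, ofList_nil]) fun h t _ rest => ?_
  cases hf : f h <;> simp [Is, hf, unary_zero, unary_succ, lvec, ofList_cons, ttE]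

def cHalf (q : ℕ) : ℕ := 20 * q + 20

theorem half_spec (a : ℕ) : Fn fHalf (unary a) (unary ((a + 1) / 2)) (cHalf a) := by
  induction a using Nat.strong_induction_on with
  | _ a ih =>
    refine .intro halfE rfl ?_
    match a with
    | 0 => simp [halfE, unary_zero, Is, cHalf]
    | 1 => simp [halfE, unary_zero, unary_succ, Is, cHalf, ttE]
    | a + 2 =>
      simp only [halfE, unary_succ, wp_split, wp_var_zero, wp_var_succ, splitP_cons, wp_cons,
        wp_nil, wp_call]
      refine (ih a (by omega)).bind fun t ht => ⟨?_, ?_⟩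
      · rw [show (a + 2 + 1) / 2 = (a + 1) / 2 + 1 by omega, unary_succ]
      · simp only [cHalf] at ht ⊢; omega

/-- The number with binary digits `l`, least significant first. -/
def bitsVal : List Bool → ℕ
  | [] => 0
  | b :: l => b.toNat + 2 * bitsVal l

theorem bitsVal_bits (n : ℕ) : bitsVal n.bits = n := by
  induction n using Nat.binaryRec' with
  | zero => simp [bitsVal]
  | bit b n h ih =>
    rw [Nat.bits_append_bit _ _ h, bitsVal, ih, Nat.bit_val]; omega

def cLeqBits (q : ℕ) : ℕ := loop q (cHalf q + 20) 20

/-- The binary number is consumed digit by digit while the unary one is halved. Capacities are never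
expanded to unary, which could be exponentially long. -/
theorem leqBits_spec (l : List Bool) {a q : ℕ} (ha : a ≤ q) (hl : l.length ≤ q) :
    Fn fLeq (.cons (unary a) (Val.ofList (l.map Val.ofBool)))
      (Val.ofBool (decide (a ≤ bitsVal l))) (cLeqBits q) := by
  refine Fn.mono ?_ (loop_mono hl)
  clear hl
  induction l generalizing a with
  | nil =>
    refine .intro leqE rfl ?_
    cases a <;> simp [leqE, unary_zero, unary_succ, Is, loop, bitsVal, ttE, ofList_nil, Val.ofBool]
  | cons b l ih =>
    refine .intro leqE rfl ?_
    cases a with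
    | zero => simp [leqE, unary_zero, Is, loop, ttE, Val.ofBool]
    | succ a =>
      -- `a ≤ b + 2x` holds iff half of `a - b`, rounded up, is at most `x`.
      have key (b : Bool) : (a + 1 - b.toNat + 1) / 2 ≤ bitsVal l ↔
          a + 1 ≤ bitsVal (b :: l) := by
        cases b <;> simp only [bitsVal, Bool.toNat_false, Bool.toNat_true] <;> omega
      cases b with
      | false =>
        simp only [leqE, List.map_cons, ofList_cons, wp_split, wp_var_zero,
          wp_var_succ, splitP_cons, wp_cons, wp_call, Val.ofBool, splitP_nil]
        refine (half_spec (a + 1)).bind fun t₁ ht₁ => ?_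
        refine (ih (by omega)).bind fun t₂ ht₂ => ⟨?_, ?_⟩
        · rw [← decide_eq_decide.2 (key false)]; rfl
        · simp only [loop, List.length_cons, Nat.add_mul, cHalf] at *; omega
      | true =>
        simp only [leqE, unary_succ, List.map_cons, ofList_cons, wp_split, wp_var_zero,
          wp_var_succ, splitP_cons, wp_cons, wp_call, Val.ofBool]
        refine (half_spec a).bind fun t₁ ht₁ => ?_
        refine (ih (by omega)).bind fun t₂ ht₂ => ⟨?_, ?_⟩
        · rw [← decide_eq_decide.2 (key true)]; rfl
        · simp only [loop, List.length_cons, Nat.add_mul, cHalf] at *; omega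

theorem leq_spec {a k q : ℕ} (ha : a ≤ q) (hk : k.size ≤ q) :
    Fn fLeq (.cons (unary a) (Val.ofNat k)) (Val.ofBool (decide (a ≤ k))) (cLeqBits q) := by
  have := leqBits_spec k.bits ha (by rwa [← Nat.size_eq_bits_len] at hk)
  rwa [bitsVal_bits] at this

def cAllLeq (q : ℕ) : ℕ := loop q (cLeqBits q + 10) 3

theorem allLeq_spec {α : Type*} {q : ℕ} (l : List α) (f g : α → ℕ) (hl : l.length ≤ q)
    (hf : ∀ i, f i ≤ q) (hg : ∀ i, (g i).size ≤ q) :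
    Fn fAllLeq (.cons (lvec l f) (Val.ofList (l.map fun i => Val.ofNat (g i))))
      (Val.ofBool (decide (∀ i ∈ l, f i ≤ g i))) (cAllLeq q) := by
  refine zipE_spec rfl _ _ (fun l => Val.ofBool (decide (∀ i ∈ l, f i ≤ g i))) l hl
    (by simp [Is, ttE, Val.ofBool]) fun h t _ rest => ?_
  simp only [wp_cons, wp_call, wp_var_zero, wp_var_succ, wp_split, wp_nil]
  refine (leq_spec (hf h) (hg h)).bind fun t₁ ht => ?_
  by_cases h' : f h ≤ g h <;> simp [h', Val.ofBool, Is] <;> omega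

/-! ## Equality and membership -/

noncomputable instance : DecidableEq Val := Classical.decEq _

def Val.weight : Val → ℕ
  | .nil => 1
  | .cons a b => a.weight + b.weight + 1

def cVeq (q : ℕ) : ℕ := 20 * q

/-- Both trees are descended in parallel, so the first one alone bounds the cost. -/
theorem veq_spec (a b : Val) : Fn fVeq (.cons a b) (Val.ofBool (decide (a = b)))
    (cVeq a.weight) := by
  induction a generalizing b with
  | nil =>
    refine .intro veqE rfl ?_
    cases b <;> simp [veqE, Is, ttE, Val.ofBool, cVeq, Val.weight]
  | cons x y ihx ihy =>
    refine .intro veqE rfl ?_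
    cases b with
    | nil => simp [veqE, Is, Val.ofBool, cVeq, Val.weight]; omega
    | cons x' y' =>
      simp only [veqE, wp_cons, wp_call, wp_var_zero, wp_var_succ, wp_split, wp_nil, splitP_cons]
      refine (ihx x').bind fun t₁ ht₁ => ?_
      by_cases h : x = x'
      · subst h
        simp only [decide_true, Val.ofBool, splitP_cons]
        refine (ihy y').bind fun t₂ ht₂ => ⟨by simp [Val.ofBool], ?_⟩
        simp only [cVeq, Val.weight] at *; omega
      · simp only [h, decide_false, Val.ofBool, splitP_nil]
        refine ⟨by simp [h], ?_⟩
        simp only [cVeq, Val.weight] at *; omega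

theorem veq_spec_of_injective {α : Type*} [DecidableEq α] {enc : α → Val}
    (h : Function.Injective enc) (a b : α) {q : ℕ} (hq : (enc a).weight ≤ q) :
    Fn fVeq (.cons (enc a) (enc b)) (Val.ofBool (decide (a = b))) (cVeq q) := by
  have := veq_spec (enc a) (enc b)
  rw [decide_eq_decide.2 h.eq_iff] at this
  exact this.mono (by unfold cVeq; omega)

def cMem (q M : ℕ) : ℕ := loop M (cVeq q + 10) 1

theorem mem_spec {α : Type*} [DecidableEq α] {enc : α → Val} (h : Function.Injective enc)
    (a : α) (l : List α) {q M : ℕ} (hq : (enc a).weight ≤ q) (hl : l.length ≤ M) :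
    Fn fMem (.cons (enc a) (Val.ofList (l.map enc))) (Val.ofBool (decide (a ∈ l)))
      (cMem q M) := by
  refine foldE_spec rfl _ (fun l => Val.ofBool (decide (a ∈ l))) _ l hl
    (by simp [Is, Val.ofBool]) fun b t _ rest => ?_
  simp only [wp_cons, wp_call, wp_var_zero, wp_var_succ, wp_split]
  refine (veq_spec_of_injective h a b hq).bind fun t₁ ht => ?_
  by_cases h' : a = b <;> simp [h', Val.ofBool, Is, ttE] <;> omega

/-! ## Further list functions -/

def cMapCons (q : ℕ) : ℕ := loop q 10 1

theorem mapCons_spec {α : Type*} {q : ℕ} (p : Val) (l : List α) (enc : α → Val)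
    (hl : l.length ≤ q) :
    Fn fMapCons (.cons p (Val.ofList (l.map enc)))
      (Val.ofList (l.map fun i => .cons p (enc i))) (cMapCons q) := by
  refine foldE_spec rfl _ (fun l => Val.ofList (l.map fun i => .cons p (enc i))) _ l hl
    (by simp [Is, ofList_nil]) fun h t _ rest => ?_
  simp [Is, ofList_cons]

theorem fsts_spec {α : Type*} {q : ℕ} (l : List α) (enc enc' : α → Val) (hl : l.length ≤ q) :
    Fn fFsts (.cons .nil (Val.ofList (l.map fun i => .cons (enc i) (enc' i))))
      (Val.ofList (l.map enc)) (cMapCons q) := by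
  refine foldE_spec rfl _ (fun l => Val.ofList (l.map enc)) _ l hl
    (by simp [Is, ofList_nil]) fun h t _ rest => ?_
  simp [Is, ofList_cons]

theorem snds_spec {α : Type*} {q : ℕ} (l : List α) (enc enc' : α → Val) (hl : l.length ≤ q) :
    Fn fSnds (.cons .nil (Val.ofList (l.map fun i => .cons (enc i) (enc' i))))
      (Val.ofList (l.map enc')) (cMapCons q) := by
  refine foldE_spec rfl _ (fun l => Val.ofList (l.map enc')) _ l hl
    (by simp [Is, ofList_nil]) fun h t _ rest => ?_
  simp [Is, ofList_cons]

def cSingles (q : ℕ) : ℕ := loop q (cMinus q + cMapCons q + 20) 1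

/-- Splits a characteristic vector into the vectors of its single entries, which a leaf introduces
one by one. The first row is the head followed by zeros; the other rows come from the tail by
prefixing a zero. `Nodup` ensures that indices of the tail differ from the head. -/
theorem singles_spec {α : Type*} [DecidableEq α] {q : ℕ} (l : List α) (f : α → ℕ)
    (hl : l.length ≤ q) (hd : l.Nodup) :
    Fn fSingles (.cons .nil (lvec l f))
      (Val.ofList (l.map fun i => lvec l fun j => if i = j then f j else 0)) (cSingles q) := by
  refine foldE_spec rfl _
    (fun l => Val.ofList (l.map fun i => lvec l fun j => if i = j then f j else 0)) _ l hl
    (by simp [Is, ofList_nil]) fun h t hs rest => ?_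
  have hd' := hd.sublist hs.sublist
  have ht : t.length ≤ q := by have := hs.length_le; simp at this; omega
  rw [List.nodup_cons] at hd'
  simp only [wp_cons, wp_call, wp_var_zero, wp_var_succ, wp_nil]
  refine (minus_spec t f f ht).bind fun t₁ ht₁ => ?_
  refine (mapCons_spec _ _ _ ht).bind fun t₂ ht₂ => ⟨?_, by omega⟩
  simp only [List.map_cons, ofList_cons, lvec, ite_true]
  refine congrArg₂ Val.cons (congrArg₂ Val.cons rfl (congrArg Val.ofList ?_))
    (congrArg Val.ofList ?_)
  · refine List.map_congr_left fun j hj => ?_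
    have : h ≠ j := by rintro rfl; exact hd'.1 hj
    rw [if_neg this, ite_eq_right_iff.2 id]
  · refine List.map_congr_left fun j hj => ?_
    have : j ≠ h := by rintro rfl; exact hd'.1 hj
    simp [this, unary_zero]

def cAllTrue (q : ℕ) : ℕ := loop q 10 3

theorem allTrue_spec {α : Type*} {q : ℕ} (l : List α) (f : α → ℕ) (hl : l.length ≤ q) :
    Fn fAllTrue (.cons .nil (lvec l f)) (Val.ofBool (decide (∀ i ∈ l, f i ≠ 0))) (cAllTrue q) := by
  refine foldE_spec rfl _ (fun l => Val.ofBool (decide (∀ i ∈ l, f i ≠ 0))) _ l hl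
    (by simp [Is, Val.ofBool, ttE]) fun h t _ rest => ?_
  cases hf : f h <;> simp [Is, hf, unary_zero, unary_succ, Val.ofBool]

end FairHS

namespace FairHS

/-! ## The dynamic program -/

/-- A fair hitting set problem with several capacitated sets. -/
structure Dat (n L m : ℕ) where
  F : Fin m → Finset (Fin n)
  W : Fin L → Finset (Fin n)
  cap : Fin L → ℕ

/-- A state: the chosen elements of the bag, the numbers of chosen forgotten elements in the
capacitated sets of the bag, and the sets hit by chosen forgotten elements. -/
abbrev St (n L m : ℕ) : Type := Finset (Fin n) × (Fin L → ℕ) × Finset (Fin m)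

abbrev Bag (n L : ℕ) : Type := Finset (Fin n ⊕ Fin L)

variable {n L m : ℕ}

namespace Dat

variable (d : Dat n L m) (b : Bag n L)

def hits (X : Finset (Fin n)) : Finset (Fin m) := {i | (X ∩ d.F i).Nonempty}

/-- Forget the elements of the state outside the bag. -/
def upd (s : St n L m) : St n L m :=
  (s.1 ∩ b.toLeft,
    fun j => if j ∈ b.toRight then s.2.1 j + ((s.1 \ b.toLeft) ∩ d.W j).card else 0,
    s.2.2 ∪ d.hits (s.1 \ b.toLeft))

/-- Forgotten elements are counted in the state, those still in the bag directly. -/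
def Ok (s : St n L m) : Prop := ∀ j ∈ b.toRight, s.2.1 j + (s.1 ∩ d.W j).card ≤ d.cap j

instance (s : St n L m) : Decidable (d.Ok b s) := by unfold Ok; infer_instance

def ins (s : St n L m) (acc : List (St n L m)) : List (St n L m) :=
  if d.Ok b s ∧ s ∉ acc then s :: acc else acc

/-- Every state is continued without `e` and with `e`, then projected to the bag. If `e` is empty
the two continuations coincide and `ins` drops the duplicate. -/
def step (e : Finset (Fin n)) (l : List (St n L m)) : List (St n L m) :=
  l.foldr (fun s r => d.ins b (d.upd b (s.1 ∪ e, s.2)) (d.ins b (d.upd b s) r)) []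

/-- Leaf bags may be nonempty, so their elements are introduced one at a time; infeasible states are
discarded at once, which keeps the intermediate tables small as well. -/
def leaf (l : List (Fin n)) : List (St n L m) :=
  l.foldr (fun i r => d.step b (b.toLeft ∩ {i}) r) [(∅, 0, ∅)]

def merge (s s' : St n L m) : St n L m := (s.1, s.2.1 + s'.2.1, s.2.2 ∪ s'.2.2)

def joinIn (s : St n L m) (acc l : List (St n L m)) : List (St n L m) :=
  l.foldr (fun s' r => if s.1 = s'.1 then d.ins b (merge s s') r else r) acc

def join (l l' : List (St n L m)) : List (St n L m) :=
  l.foldr (fun s r => d.joinIn b s r l') []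

def solve : BagTree (Fin n ⊕ Fin L) → List (St n L m)
  | .leaf b => d.leaf b (List.finRange n)
  | .one b t => d.step b (b.toLeft \ t.rootBag.toLeft) (solve t)
  | .two b t t' => d.join b (solve t) (solve t')

end Dat

/-! ## Encodings of states -/

def ind {n : ℕ} (s : Finset (Fin n)) (i : Fin n) : ℕ := if i ∈ s then 1 else 0

abbrev encSet {n : ℕ} (s : Finset (Fin n)) : Val := vec (ind s)

theorem ofFinset_eq {n : ℕ} (s : Finset (Fin n)) : Val.ofFinset s = encSet s := by
  simp only [Val.ofFinset, lvec, List.ofFn_eq_map]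
  refine congrArg _ (List.map_congr_left fun i _ => ?_)
  by_cases h : i ∈ s <;> simp [ofBool_eq_unary, ind, h]

theorem ind_ne_zero {n : ℕ} {s : Finset (Fin n)} {i : Fin n} : ind s i ≠ 0 ↔ i ∈ s := by
  simp [ind]

theorem ind_eq_zero {n : ℕ} {s : Finset (Fin n)} {i : Fin n} : ind s i = 0 ↔ i ∉ s := by
  simp [ind]

theorem ind_le_one {n : ℕ} (s : Finset (Fin n)) (i : Fin n) : ind s i ≤ 1 := by
  unfold ind; split <;> simp

def encSt (s : St n L m) : Val := .cons (encSet s.1) (.cons (vec s.2.1) (encSet s.2.2))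

def encTable (l : List (St n L m)) : Val := Val.ofList (l.map encSt)

def encBag (b : Bag n L) : Val := .cons (encSet b.toLeft) (encSet b.toRight)

def Dat.enc (d : Dat n L m) : Val :=
  .cons (Val.ofList ((List.finRange m).map fun i => encSet (d.F i)))
    (.cons (Val.ofList ((List.finRange L).map fun j => encSet (d.W j)))
      (Val.ofList ((List.finRange L).map fun j => Val.ofNat (d.cap j))))

theorem unary_injective : Function.Injective unary := by
  intro a
  induction a with
  | zero => intro b h; cases b <;> simp_all [unary_zero, unary_succ]
  | succ a ih =>
    intro b h
    cases b with
    | zero => simp [unary_zero, unary_succ] at h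
    | succ b => simp only [unary_succ, Val.cons.injEq, true_and] at h; rw [ih h]

theorem ofList_injective : Function.Injective Val.ofList := by
  intro a
  induction a with
  | nil => intro b h; cases b <;> simp_all [Val.ofList]
  | cons x a ih =>
    intro b h
    cases b with
    | nil => simp [Val.ofList] at h
    | cons y b => simp only [Val.ofList, Val.cons.injEq] at h; rw [h.1, ih h.2]

theorem vec_injective {n : ℕ} : Function.Injective (vec (n := n)) := by
  intro f g h
  have h' := ofList_injective h
  funext i
  exact unary_injective (List.map_inj_left.1 h' i (List.mem_finRange i))

theorem ind_injective {n : ℕ} : Function.Injective (ind (n := n)) := by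
  intro s t h
  ext i
  rw [← ind_ne_zero, h, ind_ne_zero]

theorem encSet_injective {n : ℕ} : Function.Injective (encSet (n := n)) :=
  vec_injective.comp ind_injective

theorem encSt_injective : Function.Injective (encSt (n := n) (L := L) (m := m)) := by
  rintro ⟨x, y, c⟩ ⟨x', y', c'⟩ h
  simp only [encSt, Val.cons.injEq] at h
  rw [encSet_injective h.1, vec_injective h.2.1, encSet_injective h.2.2]

theorem weight_unary (a : ℕ) : (unary a).weight = 2 * a + 1 := by
  induction a with
  | zero => rfl
  | succ a ih => rw [unary_succ, Val.weight, ih]; simp only [Val.weight]; omega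

theorem weight_lvec_le {α : Type*} (l : List α) (f : α → ℕ) {q : ℕ} (hf : ∀ i, f i ≤ q) :
    (lvec l f).weight ≤ l.length * (2 * q + 2) + 1 := by
  induction l with
  | nil => simp [lvec, ofList_nil, Val.weight]
  | cons i l ih =>
    simp only [lvec, List.map_cons, ofList_cons, Val.weight, weight_unary, List.length_cons,
      Nat.add_mul] at ih ⊢
    have := hf i
    omega

def cWeight (q : ℕ) : ℕ := 3 * (q * (2 * q + 2)) + 5

theorem countP_ind {n : ℕ} (s t : Finset (Fin n)) :
    (List.finRange n).countP (fun i => ind s i ≠ 0 ∧ ind t i ≠ 0) = (s ∩ t).card := by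
  have : s ∩ t = (Finset.univ : Finset (Fin n)).filter fun i => ind s i ≠ 0 ∧ ind t i ≠ 0 := by
    ext i; simp [ind]
  rw [this, Finset.card_def, Finset.filter_val, ← Multiset.countP_eq_card_filter]
  rfl

/-! ## Specifications of the state functions -/

/-- All size parameters of `d` are at most `q`. -/
structure Dat.Bounded (d : Dat n L m) (q : ℕ) : Prop where
  one_le : 1 ≤ q
  n_le : n ≤ q
  L_le : L ≤ q
  m_le : m ≤ q
  cap_le : ∀ j, (d.cap j).size ≤ q

variable {d : Dat n L m} {q : ℕ}

theorem Dat.Bounded.weight_le (hd : d.Bounded q) (s : St n L m) (hs : ∀ j, s.2.1 j ≤ q) :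
    (encSt s).weight ≤ cWeight q := by
  have h₁ := weight_lvec_le (List.finRange n) (ind s.1) fun i => (ind_le_one _ i).trans hd.one_le
  have h₂ := weight_lvec_le (List.finRange L) s.2.1 hs
  have h₃ := weight_lvec_le (List.finRange m) (ind s.2.2) fun i =>
    (ind_le_one _ i).trans hd.one_le
  have := Nat.mul_le_mul_right (2 * q + 2) hd.n_le
  have := Nat.mul_le_mul_right (2 * q + 2) hd.L_le
  have := Nat.mul_le_mul_right (2 * q + 2) hd.m_le
  simp only [List.length_finRange] at h₁ h₂ h₃
  simp only [encSt, encSet, vec, Val.weight, cWeight]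
  omega

theorem maskSet_spec (s t : Finset (Fin n)) (hn : n ≤ q) :
    Fn fMask (.cons (encSet s) (encSet t)) (encSet (t ∩ s)) (cMask q) := by
  convert mask_spec (List.finRange n) (ind s) (ind t) (by simpa) using 2
  funext i
  simp only [ind, Finset.mem_inter]; split_ifs <;> simp_all

theorem minusSet_spec (s t : Finset (Fin n)) (hn : n ≤ q) :
    Fn fMinus (.cons (encSet s) (encSet t)) (encSet (t \ s)) (cMinus q) := by
  convert minus_spec (List.finRange n) (ind s) (ind t) (by simpa) using 2
  funext i
  simp only [ind, Finset.mem_sdiff]; split_ifs <;> simp_all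

theorem unionSet_spec (s t : Finset (Fin n)) (hn : n ≤ q) :
    Fn fTrunc (.cons .nil (vec fun i => ind s i + ind t i)) (encSet (s ∪ t)) (cTrunc q) := by
  convert trunc_spec (List.finRange n) (fun i => ind s i + ind t i) (by simpa) using 2
  funext i
  simp only [ind, Finset.mem_union]; split_ifs <;> simp_all

theorem cntsSet_spec {k : ℕ} (s : Finset (Fin n)) (W : Fin k → Finset (Fin n)) (hn : n ≤ q)
    (hk : k ≤ q) :
    Fn fCnts (.cons (encSet s) (Val.ofList ((List.finRange k).map fun j => encSet (W j))))
      (vec fun j => (s ∩ W j).card) (cCnts q) := by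
  have := cnts_spec (List.finRange n) (List.finRange k) (ind s) (fun j => ind (W j))
    (by simpa) (by simpa)
  simpa only [countP_ind] using this

def cUpd (q : ℕ) : ℕ :=
  cMinus q + 2 * cMask q + 2 * cCnts q + 2 * cZipApp q + cTrunc q + 100

theorem upd_spec (hd : d.Bounded q) (b : Bag n L) (s : St n L m) (hs : ∀ j, s.2.1 j ≤ q) :
    Fn fUpd (.cons d.enc (.cons (encBag b) (encSt s))) (encSt (d.upd b s)) (cUpd q) := by
  refine .intro updE rfl ?_
  simp only [updE, Dat.enc, encBag, encSt, wp_cons, wp_call, wp_var_zero, wp_var_succ, wp_split,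
    wp_nil, splitP_cons, wp_bind]
  refine (minusSet_spec b.toLeft s.1 hd.n_le).bind fun t₁ ht₁ => ?_
  refine (maskSet_spec _ _ hd.n_le).bind fun t₂ ht₂ => ?_
  refine (cntsSet_spec _ _ hd.n_le hd.L_le).bind fun t₃ ht₃ => ?_
  refine (zipApp_spec (q := q) _ _ _ (by simpa using hd.L_le) hs).bind fun t₄ ht₄ => ?_
  refine (mask_spec (q := q) _ _ _ (by simpa using hd.L_le)).bind fun t₅ ht₅ => ?_
  refine (cntsSet_spec _ _ hd.n_le hd.m_le).bind fun t₆ ht₆ => ?_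
  refine (zipApp_spec (q := q) _ _ _ (by simpa using hd.m_le)
    fun i => (ind_le_one _ i).trans hd.one_le).bind fun t₇ ht₇ => ?_
  refine (trunc_spec (q := q) _ _ (by simpa using hd.m_le)).bind fun t₈ ht₈ => ⟨?_, ?_⟩
  · simp only [Dat.upd, vec, ind_eq_zero, ite_not]
    -- The code finds the hit sets arithmetically: the old indicator plus the number of newly
    -- forgotten elements in `F_i`, cut off at one, is the indicator of the union.
    congr 4
    funext i
    simp only [ind, Dat.hits, Finset.mem_union, Finset.mem_filter, Finset.mem_univ, true_and,
      ← Finset.card_pos]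
    split_ifs <;> first | omega | simp_all
  · simp only [cUpd]; omega

def cCheck (q : ℕ) : ℕ := cCnts q + cZipApp q + cMask q + cAllLeq q + 100

theorem check_spec (hd : d.Bounded q) (b : Bag n L) (s : St n L m) (hs : ∀ j, s.2.1 j + n ≤ q) :
    Fn fCheck (.cons d.enc (.cons (encBag b) (encSt s))) (Val.ofBool (decide (d.Ok b s)))
      (cCheck q) := by
  refine .intro checkE rfl ?_
  simp only [checkE, Dat.enc, encBag, encSt, wp_cons, wp_call, wp_var_zero, wp_var_succ, wp_split,
    wp_nil, splitP_cons]
  refine (cntsSet_spec _ _ hd.n_le hd.L_le).bind fun t₁ ht₁ => ?_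
  refine (zipApp_spec (q := q) _ _ _ (by simpa using hd.L_le)
    fun j => (Nat.le_add_right _ _).trans (hs j)).bind fun t₂ ht₂ => ?_
  refine (mask_spec (q := q) _ _ _ (by simpa using hd.L_le)).bind fun t₃ ht₃ => ?_
  refine (allLeq_spec (q := q) _ _ _ (by simpa using hd.L_le) (fun j => ?_) hd.cap_le).bind
    fun t₄ ht₄ => ⟨?_, ?_⟩
  · have := hs j
    have := (s.1 ∩ d.W j).card_le_univ
    rw [Fintype.card_fin] at this
    split_ifs <;> omega
  · congr 1
    refine decide_eq_decide.2 ?_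
    simp only [Dat.Ok, ind_eq_zero, List.mem_finRange, true_imp_iff]
    refine forall_congr' fun j => ?_
    by_cases h : j ∈ b.toRight <;> simp [h]
  · simp only [cCheck]; omega

def cIns (q M : ℕ) : ℕ := cCheck q + cMem (cWeight q) M + 100

theorem ins_spec (hd : d.Bounded q) (b : Bag n L) (s : St n L m) (hs : ∀ j, s.2.1 j + n ≤ q)
    (acc : List (St n L m)) {M : ℕ} (hM : acc.length ≤ M) :
    Fn fIns (.cons d.enc (.cons (encBag b) (.cons (encSt s) (encTable acc))))
      (encTable (d.ins b s acc)) (cIns q M) := by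
  refine .intro insE rfl ?_
  simp only [insE, wp_cons, wp_call, wp_var_zero, wp_var_succ, wp_split, wp_nil, splitP_cons]
  refine (check_spec hd b s hs).bind fun t₁ ht₁ => ?_
  by_cases h : d.Ok b s
  · simp only [h, decide_true, Val.ofBool, splitP_cons]
    refine (mem_spec encSt_injective s acc
      (hd.weight_le s fun j => (Nat.le_add_right _ _).trans (hs j)) hM).bind fun t₂ ht₂ => ?_
    by_cases h' : s ∈ acc
    · simp only [h', decide_true, Val.ofBool, splitP_cons]
      exact ⟨by simp [Dat.ins, h, h'], by simp only [cIns]; omega⟩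
    · simp only [h', decide_false, Val.ofBool, splitP_nil]
      exact ⟨by simp [Dat.ins, h, h', encTable, ofList_cons], by simp only [cIns]; omega⟩
  · simp only [h, decide_false, Val.ofBool, splitP_nil]
    exact ⟨by simp [Dat.ins, h], by simp only [cIns]; omega⟩

/-! ## Growth of tables -/

theorem Dat.suffix_ins (d : Dat n L m) (b : Bag n L) (s : St n L m) (acc : List (St n L m)) :
    acc <:+ d.ins b s acc := by
  unfold ins
  split
  · exact List.suffix_cons _ _
  · exact List.suffix_rfl

/-- Tables only grow during a loop, so a length bound for the final table holds for all intermediate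
ones. -/
theorem suffix_foldr {α β : Type*} (f : α → List β → List β) (hf : ∀ a l, l <:+ f a l)
    {l l' : List α} (h : l <:+ l') (acc : List β) : l.foldr f acc <:+ l'.foldr f acc := by
  obtain ⟨k, rfl⟩ := h
  rw [List.foldr_append]
  induction k with
  | nil => exact List.suffix_rfl
  | cons a k ih => exact ih.trans (hf _ _)

theorem Dat.suffix_joinIn (d : Dat n L m) (b : Bag n L) (s : St n L m)
    (acc l : List (St n L m)) : acc <:+ d.joinIn b s acc l := by
  refine suffix_foldr _ (fun s' r => ?_) (List.nil_suffix (l := l)) acc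
  split
  · exact d.suffix_ins _ _ _
  · exact List.suffix_rfl

/-! ## Specifications of the table functions -/

def cStep (q M : ℕ) : ℕ := loop M (2 * cIns q M + 2 * cUpd q + cTrunc q + cZipApp q + 100) 1

theorem Dat.upd_le (d : Dat n L m) (b : Bag n L) (s : St n L m) {p : ℕ} (hs : ∀ j, s.2.1 j ≤ p)
    (j : Fin L) : (d.upd b s).2.1 j ≤ p + n := by
  have := ((s.1 \ b.toLeft) ∩ d.W j).card_le_univ
  rw [Fintype.card_fin] at this
  have := hs j
  simp only [upd]; split_ifs <;> omega

/-- The slack `2 * n`: `upd` may raise a count by `n`, and the capacity test adds up to `n` bag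
elements. -/
theorem step_spec (hd : d.Bounded q) (b : Bag n L) (e : Finset (Fin n)) (l : List (St n L m))
    (hs : ∀ s ∈ l, ∀ j, s.2.1 j + 2 * n ≤ q) {M : ℕ} (hl : l.length ≤ M)
    (hM : (d.step b e l).length ≤ M) :
    Fn fStep (.cons (.cons d.enc (.cons (encBag b) (encSet e))) (encTable l))
      (encTable (d.step b e l)) (cStep q M) := by
  refine foldE_spec rfl encSt (fun l => encTable (d.step b e l)) _ l hl
    (by simp [Is, Dat.step, encTable, ofList_nil]) fun s t ht rest => ?_
  have hs' := hs s (ht.subset (List.mem_cons_self ..))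
  have hle : (d.step b e (s :: t)).length ≤ M :=
    (suffix_foldr _ (fun s r => (d.suffix_ins b _ r).trans (d.suffix_ins b _ _)) ht
      []).length_le.trans hM
  have hle₂ : (d.ins b (d.upd b s) (d.step b e t)).length ≤ M :=
    (d.suffix_ins b _ _).length_le.trans hle
  have hle₁ : (d.step b e t).length ≤ M := (d.suffix_ins b _ _).length_le.trans hle₂
  have hy (x : Finset (Fin n)) (j : Fin L) : (d.upd b (x, s.2)).2.1 j + n ≤ q := by
    have hp : ∀ j, s.2.1 j ≤ q - 2 * n := fun j => by have := hs' j; omega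
    have := d.upd_le b (x, s.2) hp j
    have := hs' j
    omega
  simp only [stepC, wp_cons, wp_call, wp_var_zero, wp_var_succ, wp_split, wp_nil, splitP_cons,
    encSt]
  refine (zipApp_spec (q := q) _ _ _ (by simpa using hd.n_le)
    fun i => (ind_le_one _ i).trans hd.one_le).bind fun t₁ ht₁ => ?_
  refine (unionSet_spec s.1 e hd.n_le).bind fun t₂ ht₂ => ?_
  refine (upd_spec hd b (s.1 ∪ e, s.2) fun j => by have := hs' j; simp only; omega).bind
    fun t₃ ht₃ => ?_
  refine (upd_spec hd b s fun j => by have := hs' j; omega).bind fun t₄ ht₄ => ?_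
  refine (ins_spec hd b _ (hy s.1) _ hle₁).bind fun t₅ ht₅ => ?_
  refine (ins_spec hd b _ (hy (s.1 ∪ e)) _ hle₂).bind fun t₆ ht₆ => ⟨rfl, by omega⟩

end FairHS

namespace FairHS

variable {n L m : ℕ} {d : Dat n L m} {q : ℕ}

def cLeafInit (q : ℕ) : ℕ := cMinus q + 2 * cCnts q + 100

def cLeaf (q M : ℕ) : ℕ := loop q (cStep q M + 100) (cLeafInit q)

theorem leaf_spec (hd : d.Bounded q) (b : Bag n L) {M : ℕ}
    (hM : ∀ l, l <:+ List.finRange n → (d.leaf b l).length ≤ M)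
    (hs : ∀ l, l <:+ List.finRange n → ∀ s ∈ d.leaf b l, ∀ j, s.2.1 j + 2 * n ≤ q) :
    Fn fLeaf (.cons (.cons d.enc (encBag b))
        (Val.ofList ((List.finRange n).map fun i => encSet (b.toLeft ∩ {i}))))
      (encTable (d.leaf b (List.finRange n))) (cLeaf q M) := by
  refine foldE_spec rfl (fun i => encSet (b.toLeft ∩ {i})) (fun l => encTable (d.leaf b l)) _
    (List.finRange n) (by simpa using hd.n_le) (fun rest => ?_) fun i t ht rest => ?_
  · simp only [leafN, Dat.enc, encBag, wp_cons, wp_call, wp_var_zero, wp_var_succ, wp_split,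
      wp_nil, splitP_cons, wp_bind]
    refine (minusSet_spec b.toLeft b.toLeft hd.n_le).bind fun t₁ ht₁ => ?_
    refine (cntsSet_spec _ _ hd.n_le hd.L_le).bind fun t₂ ht₂ => ?_
    refine (cntsSet_spec _ _ hd.n_le hd.m_le).bind fun t₃ ht₃ => ⟨?_, ?_⟩
    · simp only [Finset.sdiff_self, Finset.empty_inter, Finset.card_empty, Dat.leaf,
        List.foldr_nil, encTable, List.map_cons, List.map_nil, ofList_cons, ofList_nil, encSt]
      rfl
    · simp only [cLeafInit]; omega
  · simp only [leafC, wp_cons, wp_call, wp_var_zero, wp_var_succ, wp_split, wp_nil, splitP_cons]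
    have ht' := (List.suffix_cons i t).trans ht
    refine (step_spec hd b _ _ (hs t ht') (hM t ht') (hM _ ht)).bind fun t₁ ht₁ => ⟨rfl, ?_⟩
    omega

def cJoinIn (q M : ℕ) : ℕ :=
  loop M (cVeq (cWeight q) + 2 * cZipApp q + cTrunc q + cIns q M + 100) 20

theorem weight_encSet_le (hd : d.Bounded q) (s : Finset (Fin n)) :
    (encSet s).weight ≤ cWeight q := by
  have h := hd.weight_le (s, 0, ∅) (by simp)
  simp only [encSt, Val.weight] at h
  omega

/-- A merged count is at most `2 * p`, and the capacity test adds up to `n`. -/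
theorem joinIn_spec (hd : d.Bounded q) (b : Bag n L) (s : St n L m) (acc l : List (St n L m))
    {p M : ℕ} (hp : 2 * p + n ≤ q) (hs : ∀ j, s.2.1 j ≤ p) (hs' : ∀ s ∈ l, ∀ j, s.2.1 j ≤ p)
    (hl : l.length ≤ M) (hM : (d.joinIn b s acc l).length ≤ M) :
    Fn fJoinIn (.cons (.cons d.enc (.cons (encBag b) (.cons (encSt s) (encTable acc))))
      (encTable l)) (encTable (d.joinIn b s acc l)) (cJoinIn q M) := by
  refine foldE_spec rfl encSt (fun l => encTable (d.joinIn b s acc l)) _ l hl (fun rest => ?_)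
    fun s' t ht rest => ?_
  · simp [joinInN, Is, Dat.joinIn]
  have h' := hs' s' (ht.subset (List.mem_cons_self ..))
  have hle : (d.joinIn b s acc (s' :: t)).length ≤ M := by
    refine (List.IsSuffix.length_le (suffix_foldr _ (fun s'' r => ?_) ht acc)).trans hM
    split
    · exact d.suffix_ins _ _ _
    · exact List.suffix_rfl
  simp only [joinInC, wp_cons, wp_call, wp_var_zero, wp_var_succ, wp_split, wp_nil, splitP_cons,
    encSt]
  refine (veq_spec_of_injective encSet_injective s.1 s'.1 (weight_encSet_le hd _)).bind
    fun t₁ ht₁ => ?_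
  by_cases h : s.1 = s'.1
  · simp only [h, decide_true, Val.ofBool, splitP_cons]
    simp only [← h]
    refine (zipApp_spec (q := q) _ _ _ (by simpa using hd.L_le)
      fun j => by have := hs j; omega).bind fun t₂ ht₂ => ?_
    refine (zipApp_spec (q := q) _ _ _ (by simpa using hd.m_le)
      fun i => (ind_le_one _ i).trans hd.one_le).bind fun t₃ ht₃ => ?_
    refine (unionSet_spec s.2.2 s'.2.2 hd.m_le).bind fun t₄ ht₄ => ?_
    have hj : d.joinIn b s acc (s' :: t) = d.ins b (Dat.merge s s') (d.joinIn b s acc t) := by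
      simp [Dat.joinIn, h]
    refine (ins_spec hd b (Dat.merge s s') (fun j => ?_) (d.joinIn b s acc t) (M := M) ?_).bind
      fun t₅ ht₅ => ⟨by rw [hj], by omega⟩
    · have := h' j; have := hs j; simp only [Dat.merge, Pi.add_apply]; omega
    · rw [hj] at hle
      exact (d.suffix_ins _ _ _).length_le.trans hle
  · simp only [h, decide_false, Val.ofBool, splitP_nil]
    exact ⟨by simp [Dat.joinIn, h], by omega⟩

def cJoin (q M : ℕ) : ℕ := loop M (cJoinIn q M + 100) 1

theorem join_spec (hd : d.Bounded q) (b : Bag n L) (l l' : List (St n L m))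
    {p M : ℕ} (hp : 2 * p + n ≤ q) (hs : ∀ s ∈ l, ∀ j, s.2.1 j ≤ p)
    (hs' : ∀ s ∈ l', ∀ j, s.2.1 j ≤ p)
    (hl : l.length ≤ M) (hl' : l'.length ≤ M) (hM : (d.join b l l').length ≤ M) :
    Fn fJoin (.cons (.cons d.enc (.cons (encBag b) (encTable l'))) (encTable l))
      (encTable (d.join b l l')) (cJoin q M) := by
  refine foldE_spec rfl encSt (fun l => encTable (d.join b l l')) _ l hl
    (by simp [Is, Dat.join, encTable, ofList_nil]) fun s t ht rest => ?_
  have hle : (d.join b (s :: t) l').length ≤ M :=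
    (suffix_foldr _ (fun s r => d.suffix_joinIn b s r l') ht []).length_le.trans hM
  simp only [joinC, wp_cons, wp_call, wp_var_zero, wp_var_succ, wp_split, wp_nil, splitP_cons]
  refine (joinIn_spec hd b s _ l' hp (hs s (ht.subset (List.mem_cons_self ..))) hs' hl' hle).bind
    fun t₁ ht₁ => ⟨rfl, by omega⟩

/-! ## The recursion over the decomposition -/

/-- Add the vertex `0` to all bags, shifting the other vertices on the right. -/
def augBag {l : ℕ} (b : Finset (Fin n ⊕ Fin l)) : Bag n (l + 1) :=
  b.toLeft.disjSum (insert 0 (b.toRight.map (Fin.succEmb l)))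

end FairHS

namespace FairHS.BagTree

def map {V V' : Type*} (f : Finset V → Finset V') : BagTree V → BagTree V'
  | leaf b => leaf (f b)
  | one b t => one (f b) (t.map f)
  | two b t t' => two (f b) (t.map f) (t'.map f)

theorem rootBag_map {V V' : Type*} (f : Finset V → Finset V') (t : BagTree V) :
    (t.map f).rootBag = f t.rootBag := by
  cases t <;> rfl

end FairHS.BagTree

namespace FairHS

variable {n l m : ℕ} {d : Dat n (l + 1) m} {q M : ℕ}

theorem encBag_augBag (b : Finset (Fin n ⊕ Fin l)) :
    encBag (augBag b) = .cons (encSet b.toLeft) (.cons (unary 1) (encSet b.toRight)) := by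
  simp only [encBag, augBag, Finset.toLeft_disjSum, Finset.toRight_disjSum]
  congr 1
  simp only [encSet, vec, lvec, List.finRange_succ, List.map_cons, ofList_cons, List.map_map]
  congr 1
  · simp [ind]
  · congr 1
    refine List.map_congr_left fun j _ => ?_
    simp [ind]

theorem ofBag_eq (b : Finset (Fin n ⊕ Fin l)) :
    Val.ofBag b = .cons (encSet b.toLeft) (encSet b.toRight) := by
  simp only [← ofFinset_eq, Val.ofBag, Val.ofFinset, Finset.mem_toLeft, Finset.mem_toRight]

/-- The tables of all nodes (including the intermediate tables of the leaves) are small. -/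
def Small (d : Dat n (l + 1) m) (p M : ℕ) : BagTree (Fin n ⊕ Fin (l + 1)) → Prop
  | .leaf b => ∀ l, l <:+ List.finRange n →
      (d.leaf b l).length ≤ M ∧ ∀ s ∈ d.leaf b l, ∀ j, s.2.1 j ≤ p
  | .one b t => Small d p M t ∧ (d.solve (.one b t)).length ≤ M ∧
      ∀ s ∈ d.solve (.one b t), ∀ j, s.2.1 j ≤ p
  | .two b t t' => Small d p M t ∧ Small d p M t' ∧ (d.solve (.two b t t')).length ≤ M ∧
      ∀ s ∈ d.solve (.two b t t'), ∀ j, s.2.1 j ≤ p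

theorem Small.root {p : ℕ} {t : BagTree (Fin n ⊕ Fin (l + 1))} (h : Small d p M t) :
    (d.solve t).length ≤ M ∧ ∀ s ∈ d.solve t, ∀ j, s.2.1 j ≤ p := by
  cases t with
  | leaf b => exact h _ List.suffix_rfl
  | one b t => exact h.2
  | two b t t' => exact h.2.2

def cNode (q M : ℕ) : ℕ := cSingles q + cLeaf q M + cMinus q + cStep q M + cJoin q M + 100

theorem singlesSet_spec (s : Finset (Fin n)) (hn : n ≤ q) :
    Fn fSingles (.cons .nil (encSet s))
      (Val.ofList ((List.finRange n).map fun i => encSet (s ∩ {i}))) (cSingles q) := by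
  convert singles_spec (List.finRange n) (ind s) (by simpa) (List.nodup_finRange n) using 5 with i
  funext j
  by_cases h : i = j
  · subst h; simp [ind]
  · simp [ind, h, Ne.symm h]

/-- The code reads the original tree and adds the budget vertex on the fly, while its result is
described by the augmented tree. -/
theorem solve_spec (hd : d.Bounded q) (hq : 3 * n ≤ q)
    (t : BagTree (Fin n ⊕ Fin l)) (ht : Small d n M (t.map augBag)) :
    Fn fSolve (.cons d.enc t.encode) (encTable (d.solve (t.map augBag)))
      (t.numNodes * cNode q M) := by
  induction t with
  | leaf b =>
    refine .intro solveE rfl ?_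
    simp only [solveE, BagTree.encode, ofBag_eq, ofList_cons, ofList_nil, wp_cons, wp_call,
      wp_var_zero, wp_var_succ, wp_split, wp_nil, splitP_cons, splitP_nil, wp_bind, ttE_wp]
    refine (singlesSet_spec _ hd.n_le).bind fun t₁ ht₁ => ?_
    rw [← encBag_augBag]
    have hb : b.toLeft = (augBag b).toLeft := by simp [augBag]
    rw [hb]
    refine (leaf_spec hd (augBag b) (fun l hl => (ht l hl).1) fun l hl s hs j => ?_).bind
      fun t₂ ht₂ => ⟨rfl, ?_⟩
    · have := (ht l hl).2 s hs j; omega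
    · simp only [BagTree.numNodes, cNode]; omega
  | one b t ih =>
    refine .intro solveE rfl ?_
    obtain ⟨ht', hr⟩ := ht
    simp only [solveE, BagTree.encode, ofBag_eq, ofList_cons, ofList_nil, wp_cons, wp_call,
      wp_var_zero, wp_var_succ, wp_split, wp_nil, splitP_cons, splitP_nil, wp_bind, ttE_wp]
    refine (ih ht').bind fun t₁ ht₁ => ?_
    -- Only the root bag of the child is inspected here, so its shape need not be distinguished.
    obtain ⟨y, z, hy⟩ : ∃ y z, t.encode = .cons (.cons (encSet t.rootBag.toLeft) y) z := by
      cases t <;> simp only [BagTree.encode, ofBag_eq, ofList_cons, BagTree.rootBag] <;>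
        exact ⟨_, _, rfl⟩
    simp only [hy, splitP_cons]
    refine (minusSet_spec _ _ hd.n_le).bind fun t₂ ht₂ => ?_
    rw [← encBag_augBag]
    have hb : b.toLeft \ t.rootBag.toLeft =
        (augBag b).toLeft \ (t.map augBag).rootBag.toLeft := by
      simp [augBag, BagTree.rootBag_map]
    rw [hb]
    refine (step_spec hd (augBag b) _ _ (fun s hs j => ?_) ht'.root.1 hr.1).bind
      fun t₂ ht₂ => ⟨rfl, ?_⟩
    · have := ht'.root.2 s hs j; omega
    · simp only [BagTree.numNodes, Nat.add_mul]; simp only [cNode] at *; omega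
  | two b t t' ih ih' =>
    refine .intro solveE rfl ?_
    obtain ⟨ht, ht', hr⟩ := ht
    simp only [solveE, BagTree.encode, ofBag_eq, ofList_cons, ofList_nil, wp_cons, wp_call,
      wp_var_zero, wp_var_succ, wp_split, wp_nil, splitP_cons, wp_bind, ttE_wp]
    refine (ih ht).bind fun t₁ ht₁ => ?_
    refine (ih' ht').bind fun t₂ ht₂ => ?_
    rw [← encBag_augBag]
    refine (join_spec hd (augBag b) _ _ (p := n) (by omega) ht.root.2 ht'.root.2 ht.root.1
      ht'.root.1 hr.1).bind fun t₂ ht₂ => ⟨rfl, ?_⟩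
    simp only [BagTree.numNodes, Nat.add_mul]; simp only [cNode] at *; omega

/-! ## The main program -/

def cAnyFull (q M : ℕ) : ℕ := loop M (cAllTrue q + 20) 1

theorem anyFull_spec {L : ℕ} (T : List (St n L m)) (hm : m ≤ q) (hM : T.length ≤ M) :
    Fn fAnyFull (.cons .nil (encTable T)) (Val.ofBool (decide (∃ s ∈ T, s.2.2 = Finset.univ)))
      (cAnyFull q M) := by
  refine foldE_spec rfl encSt
    (fun T => Val.ofBool (decide (∃ s ∈ T, s.2.2 = Finset.univ))) _ T hM
    (by simp [Is, Val.ofBool]) fun s t _ rest => ?_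
  simp only [wp_cons, wp_call, wp_var_zero, wp_var_succ, wp_split, wp_nil, splitP_cons, encSt]
  refine (allTrue_spec (q := q) _ _ (by simpa)).bind fun t₁ ht₁ => ?_
  have : (∀ i ∈ List.finRange m, ind s.2.2 i ≠ 0) ↔ s.2.2 = Finset.univ := by
    simp [ind_ne_zero, Finset.eq_univ_iff_forall]
  rw [decide_eq_decide.2 this]
  by_cases h : s.2.2 = Finset.univ
  · rw [decide_eq_true h]
    simp only [Val.ofBool, splitP_cons, ttE_wp]
    exact ⟨by rw [decide_eq_true ⟨s, List.mem_cons_self .., h⟩]; rfl, by omega⟩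
  · rw [decide_eq_false h]
    simp only [Val.ofBool, splitP_nil]
    exact ⟨congrArg Val.ofBool (decide_eq_decide.2 (by simp [h])), by omega⟩

/-- The budget constraint becomes the capacitated set number `0`. -/
def Instance.dat (I : Instance) : Dat I.n (I.l + 1) I.m where
  F := I.F
  W := Fin.cons Finset.univ I.B
  cap := Fin.cons I.k I.cap

theorem Instance.enc_dat (I : Instance) : I.dat.enc =
    .cons (Val.ofList ((List.finRange I.m).map fun i => encSet (I.F i)))
      (.cons (.cons (encSet (Finset.univ : Finset (Fin I.n))) (Val.ofList ((List.finRange I.l).map fun j => encSet (I.B j))))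
        (.cons (Val.ofNat I.k) (Val.ofList ((List.finRange I.l).map fun j => Val.ofNat (I.cap j))))) := by
  simp only [Dat.enc, Instance.dat, List.finRange_succ, List.map_cons, ofList_cons, List.map_map,
    Fin.cons_zero]
  rfl

def cMain (q M N : ℕ) : ℕ := cTrunc q + 3 * cMapCons q + N * cNode q M + cAnyFull q M + 100

/-- Pairing with `nil` is the successor on unary numbers, so every entry becomes positive and is
truncated to one. -/
theorem trunc_mapCons_spec (s : Finset (Fin n)) (hn : n ≤ q) :
    Fn fTrunc (.cons .nil (Val.ofList ((List.finRange n).map fun i => .cons .nil (unary (ind s i)))))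
      (encSet (Finset.univ : Finset (Fin n))) (cTrunc q) := by
  have := trunc_spec (List.finRange n) (fun i => ind s i + 1) (q := q) (by simpa)
  simpa [encSet, vec, lvec, unary_succ, ind] using this

theorem program_spec (I : Instance) (T : BagTree (Fin I.n ⊕ Fin I.l)) (hd : I.dat.Bounded q)
    (hq : 3 * I.n ≤ q) (hT : Small I.dat I.n M (T.map augBag)) :
    ∃ t ≤ cMain q M T.numNodes, program.Runs (.cons I.encode T.encode)
      (Val.ofBool (decide (∃ s ∈ I.dat.solve (T.map augBag), s.2.2 = Finset.univ))) t := by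
  suffices h : Wp [.cons I.encode T.encode] mainE
      (Is (Val.ofBool (decide (∃ s ∈ I.dat.solve (T.map augBag), s.2.2 = Finset.univ)))
        (cMain q M T.numNodes)) by
    obtain ⟨v, t, h, rfl, ht⟩ := h
    exact ⟨t, ht, h⟩
  obtain ⟨y, z, hy⟩ : ∃ y z, T.encode = .cons (.cons (encSet T.rootBag.toLeft) y) z := by
    cases T <;> simp only [BagTree.encode, ofBag_eq, ofList_cons, BagTree.rootBag] <;>
      exact ⟨_, _, rfl⟩
  simp only [mainE, Instance.encode, List.ofFn_eq_map, ofFinset_eq, ofList_cons, ofList_nil, wp_cons, wp_call,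
    wp_var_zero, wp_var_succ, wp_split, wp_nil, splitP_cons, hy]
  refine (mapCons_spec _ _ _ (by simpa using hd.n_le)).bind fun t₁ ht₁ => ?_
  refine (trunc_mapCons_spec _ hd.n_le).bind fun t₂ ht₂ => ?_
  have hl : I.l ≤ q := (Nat.le_succ _).trans hd.L_le
  refine (fsts_spec _ _ _ (by simpa using hl)).bind fun t₃ ht₃ => ?_
  refine (snds_spec _ _ _ (by simpa using hl)).bind fun t₄ ht₄ => ?_
  rw [← Instance.enc_dat, ← hy]
  refine (solve_spec hd hq T hT).bind fun t₅ ht₅ => ?_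
  refine (anyFull_spec _ hd.m_le hT.root.1).bind fun t₆ ht₆ => ⟨rfl, ?_⟩
  simp only [cMain]; omega

end FairHS

/-! ### Partial solutions, their states, and correctness of the tables -/

namespace FairHS

variable {n L m : ℕ}

def BagTree.verts {V : Type*} [DecidableEq V] : BagTree V → Finset V
  | .leaf b => b
  | .one b t => b ∪ t.verts
  | .two b t t' => b ∪ (t.verts ∪ t'.verts)

theorem BagTree.rootBag_subset_verts {V : Type*} [DecidableEq V] (t : BagTree V) :
    t.rootBag ⊆ t.verts := by
  cases t <;> simp [rootBag, verts]

namespace Dat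

variable (d : Dat n L m) (b : Bag n L)

/-- The state of a partial solution at a node with bag `b`. -/
def sig (S : Finset (Fin n)) : St n L m :=
  (S ∩ b.toLeft, fun j => if j ∈ b.toRight then ((S \ b.toLeft) ∩ d.W j).card else 0,
    d.hits (S \ b.toLeft))

/-- `S` is a partial solution on the vertex set `X`. -/
def Valid (X : Bag n L) (S : Finset (Fin n)) : Prop :=
  S ⊆ X.toLeft ∧ ∀ j ∈ X.toRight, (S ∩ d.W j).card ≤ d.cap j

/-- A child subtree `t` of a node with bag `b` is connected to the outside through `b` only. -/
structure Attach (t : BagTree (Fin n ⊕ Fin L)) : Prop where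
  inter : ∀ v ∈ t.verts, v ∈ b → v ∈ t.rootBag
  right : ∀ u j, u ∈ d.W j → .inl u ∈ t.verts → .inl u ∉ b → .inr j ∈ t.verts
  left : ∀ u j, u ∈ d.W j → .inr j ∈ t.verts → .inr j ∉ b → .inl u ∈ t.verts

/-- What correctness needs of the augmented decomposition, stated node by node. The bound `≤ 1` is
there because `step` offers only none or all of the new elements. -/
def Good : BagTree (Fin n ⊕ Fin L) → Prop
  | .leaf _ => True
  | .one b t => d.Attach b t ∧ (b.toLeft \ t.rootBag.toLeft).card ≤ 1 ∧ Good t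
  | .two b t t' => d.Attach b t ∧ d.Attach b t' ∧ t.rootBag = b ∧ t'.rootBag = b ∧
      t.verts ∩ t'.verts ⊆ b ∧ Good t ∧ Good t'

/-! ## Membership in tables -/

theorem mem_ins {s s' : St n L m} {acc : List (St n L m)} :
    s' ∈ d.ins b s acc ↔ (s' = s ∧ d.Ok b s') ∨ s' ∈ acc := by
  unfold ins
  split_ifs with h
  · rw [List.mem_cons]
    constructor
    · rintro (rfl | h'); exacts [.inl ⟨rfl, h.1⟩, .inr h']
    · rintro (h' | h'); exacts [.inl h'.1, .inr h']
  · refine ⟨.inr, ?_⟩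
    rintro (⟨rfl, h'⟩ | h')
    · by_contra h''; exact h ⟨h', h''⟩
    · exact h'

theorem nodup_ins {s : St n L m} {acc : List (St n L m)} (h : acc.Nodup) :
    (d.ins b s acc).Nodup := by
  unfold ins
  split_ifs with h'
  · exact List.nodup_cons.2 ⟨h'.2, h⟩
  · exact h

theorem mem_step {e : Finset (Fin n)} {l : List (St n L m)} {s : St n L m} :
    s ∈ d.step b e l ↔
      ∃ s' ∈ l, ∃ D, (D = ∅ ∨ D = e) ∧ s = d.upd b (s'.1 ∪ D, s'.2) ∧ d.Ok b s := by
  induction l with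
  | nil => simp [step]
  | cons s' l ih =>
    have : d.step b e (s' :: l) =
      d.ins b (d.upd b (s'.1 ∪ e, s'.2)) (d.ins b (d.upd b s') (d.step b e l)) := rfl
    rw [this, mem_ins, mem_ins, ih]
    simp only [List.mem_cons, or_and_right, exists_or, exists_eq_left, Finset.union_empty]
    rw [or_assoc, or_left_comm]

theorem nodup_step (e : Finset (Fin n)) (l : List (St n L m)) : (d.step b e l).Nodup := by
  induction l with
  | nil => exact List.nodup_nil
  | cons s' l ih => exact d.nodup_ins b (d.nodup_ins b ih)

theorem mem_joinIn {s s' : St n L m} {acc l : List (St n L m)} :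
    s' ∈ d.joinIn b s acc l ↔
      (∃ s₂ ∈ l, s.1 = s₂.1 ∧ s' = merge s s₂ ∧ d.Ok b s') ∨ s' ∈ acc := by
  induction l with
  | nil => simp [joinIn]
  | cons s₂ l ih =>
    have : d.joinIn b s acc (s₂ :: l) = if s.1 = s₂.1 then d.ins b (merge s s₂) (d.joinIn b s acc l)
      else d.joinIn b s acc l := rfl
    rw [this]
    simp only [List.mem_cons, exists_eq_or_imp]
    split_ifs with h
    · rw [mem_ins, ih]; simp only [h, true_and, or_assoc]
    · rw [ih]; simp only [h, false_and, false_or]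

theorem nodup_joinIn {s : St n L m} {acc : List (St n L m)} (h : acc.Nodup)
    (l : List (St n L m)) : (d.joinIn b s acc l).Nodup := by
  induction l with
  | nil => exact h
  | cons s' l ih =>
    have : d.joinIn b s acc (s' :: l) = if s.1 = s'.1 then d.ins b (merge s s') (d.joinIn b s acc l)
      else d.joinIn b s acc l := rfl
    rw [this]
    split_ifs
    exacts [d.nodup_ins b ih, ih]

theorem mem_join {s : St n L m} {l l' : List (St n L m)} :
    s ∈ d.join b l l' ↔
      ∃ s₁ ∈ l, ∃ s₂ ∈ l', s₁.1 = s₂.1 ∧ s = merge s₁ s₂ ∧ d.Ok b s := by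
  induction l with
  | nil => simp [join]
  | cons s₁ l ih =>
    have : d.join b (s₁ :: l) l' = d.joinIn b s₁ (d.join b l l') l' := rfl
    rw [this, mem_joinIn, ih]
    simp only [List.mem_cons, exists_eq_or_imp]

theorem nodup_join (l l' : List (St n L m)) : (d.join b l l').Nodup := by
  induction l with
  | nil => exact List.nodup_nil
  | cons s l ih => exact d.nodup_joinIn b ih _

/-! ## States of partial solutions -/

theorem hits_union (X Y : Finset (Fin n)) : d.hits (X ∪ Y) = d.hits X ∪ d.hits Y := by
  ext i
  simp only [hits, Finset.union_inter_distrib_right, Finset.union_nonempty, Finset.mem_filter,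
    Finset.mem_univ, true_and, Finset.mem_union]

/-- The forgotten part and the bag part of `S` partition it, so the tested sum is `|S ∩ W_j|`. -/
theorem ok_sig (S : Finset (Fin n)) :
    d.Ok b (d.sig b S) ↔ ∀ j ∈ b.toRight, (S ∩ d.W j).card ≤ d.cap j := by
  refine forall₂_congr fun j hj => ?_
  simp only [sig, if_pos hj]
  rw [← Finset.card_union_of_disjoint, ← Finset.union_inter_distrib_right,
    Finset.sdiff_union_inter]
  refine Finset.disjoint_left.2 fun u => ?_
  simp; tauto

variable {d b}

/-- The elements forgotten below and those forgotten now are disjoint, with union `(S ∪ D) \ b`;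
counts add and hit families unite. -/
theorem Attach.upd_sig {t : BagTree (Fin n ⊕ Fin L)} (h : d.Attach b t) {S D : Finset (Fin n)}
    (hS : S ⊆ t.verts.toLeft) (hD : D ⊆ b.toLeft \ t.rootBag.toLeft) :
    d.upd b ((d.sig t.rootBag S).1 ∪ D, (d.sig t.rootBag S).2) = d.sig b (S ∪ D) := by
  have hS' : ∀ u ∈ S, .inl u ∈ t.verts := fun u hu => by simpa using hS hu
  have hD' : ∀ u ∈ D, .inl u ∈ b ∧ .inl u ∉ t.rootBag := fun u hu => by simpa using hD hu
  have hb : ∀ u ∈ S, .inl u ∈ b → .inl u ∈ t.rootBag := fun u hu hub => h.inter _ (hS' u hu) hub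
  have hsets : (S \ t.rootBag.toLeft) ∪ ((S ∩ t.rootBag.toLeft ∪ D) \ b.toLeft) =
      (S ∪ D) \ b.toLeft := by
    ext u
    have := hb u; have := hD' u
    simp only [Finset.mem_union, Finset.mem_sdiff, Finset.mem_inter, Finset.mem_toLeft]
    tauto
  have hdisj : Disjoint (S \ t.rootBag.toLeft) ((S ∩ t.rootBag.toLeft ∪ D) \ b.toLeft) := by
    refine Finset.disjoint_left.2 fun u => ?_
    have := hD' u
    simp only [Finset.mem_union, Finset.mem_sdiff, Finset.mem_inter, Finset.mem_toLeft]
    tauto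
  simp only [upd, sig]
  refine Prod.ext ?_ (Prod.ext ?_ ?_)
  · ext u
    have := hb u
    simp only [Finset.mem_union, Finset.mem_inter, Finset.mem_toLeft]
    tauto
  · funext j
    by_cases hj : j ∈ b.toRight
    · simp only [if_pos hj]
      -- For a set `j` just introduced, the stored value `0` is the true count: a forgotten `u ∈
      -- W_j` would place `j` in the subtree, hence in the child's bag.
      have : (if j ∈ t.rootBag.toRight then ((S \ t.rootBag.toLeft) ∩ d.W j).card else 0) =
          ((S \ t.rootBag.toLeft) ∩ d.W j).card := by
        rw [ite_eq_left_iff]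
        intro hj'
        symm
        rw [Finset.card_eq_zero, Finset.eq_empty_iff_forall_notMem]
        intro u hu
        simp only [Finset.mem_inter, Finset.mem_sdiff, Finset.mem_toLeft] at hu
        refine hj' (Finset.mem_toRight.2 (h.inter _ ?_ (Finset.mem_toRight.1 hj)))
        exact h.right u j hu.2 (hS' u hu.1.1) fun hub => hu.1.2 (hb u hu.1.1 hub)
      rw [this, ← hsets, Finset.union_inter_distrib_right, Finset.card_union_of_disjoint]
      exact hdisj.mono Finset.inter_subset_left Finset.inter_subset_left
    · simp only [if_neg hj]
  · simp only
    rw [← hits_union, hsets]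

/-- Sets in `b` are covered by the test. A set of the subtree outside `b` contains no new element,
since such an element would already lie in the subtree and so in the child's bag. -/
theorem Attach.valid_union {t : BagTree (Fin n ⊕ Fin L)} (h : d.Attach b t) {S D : Finset (Fin n)}
    (hS : d.Valid t.verts S) (hD : D ⊆ b.toLeft \ t.rootBag.toLeft)
    (hok : d.Ok b (d.sig b (S ∪ D))) : d.Valid (b ∪ t.verts) (S ∪ D) := by
  have hD' : ∀ u ∈ D, .inl u ∈ b ∧ .inl u ∉ t.rootBag := fun u hu => by simpa using hD hu
  rw [ok_sig] at hok
  constructor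
  · intro u hu
    rw [Finset.mem_toLeft, Finset.mem_union]
    rcases Finset.mem_union.1 hu with hu | hu
    · exact .inr (by simpa using hS.1 hu)
    · exact .inl (hD' u hu).1
  · intro j hj
    by_cases hjb : j ∈ b.toRight
    · exact hok j hjb
    · have hjt : .inr j ∈ t.verts := by
        rw [Finset.mem_toRight, Finset.mem_union] at hj
        exact hj.resolve_left (by simpa using hjb)
      rw [Finset.union_inter_distrib_right]
      have : D ∩ d.W j = ∅ := by
        rw [Finset.eq_empty_iff_forall_notMem]
        intro u hu
        rw [Finset.mem_inter] at hu
        refine (hD' u hu.1).2 (h.inter _ (h.left u j hu.2 hjt ?_) (hD' u hu.1).1)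
        simpa using hjb
      rw [this, Finset.union_empty]
      exact hS.2 j (by simpa using hjt)

theorem Valid.mono {X Y : Bag n L} {S S' : Finset (Fin n)} (h : d.Valid X S) (hXY : Y ⊆ X)
    (hS : S' ⊆ S) (hS' : S' ⊆ Y.toLeft) : d.Valid Y S' :=
  ⟨hS', fun j hj => (Finset.card_le_card (Finset.inter_subset_inter_right hS)).trans
    (h.2 j (Finset.mem_toRight.2 (hXY (Finset.mem_toRight.1 hj))))⟩

theorem Valid.ok {X : Bag n L} {S : Finset (Fin n)} (h : d.Valid X S) (hb : b ⊆ X) :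
    d.Ok b (d.sig b S) :=
  (ok_sig d b S).2 fun j hj => h.2 j (Finset.mem_toRight.2 (hb (Finset.mem_toRight.1 hj)))

/-- An element forgotten on both sides would lie in `X ∩ Y ⊆ b`; hence no element is counted twice.
-/
theorem merge_sig {X Y : Bag n L} (hXY : X ∩ Y ⊆ b) {S S' : Finset (Fin n)}
    (hS : S ⊆ X.toLeft) (hS' : S' ⊆ Y.toLeft) (h : S ∩ b.toLeft = S' ∩ b.toLeft) :
    merge (d.sig b S) (d.sig b S') = d.sig b (S ∪ S') := by
  simp only [merge, sig, Finset.union_sdiff_distrib, Finset.union_inter_distrib_right, ← h,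
    Finset.union_self, hits_union, Prod.mk.injEq, and_true, true_and]
  funext j
  simp only [Pi.add_apply]
  split_ifs
  · rw [Finset.card_union_of_disjoint]
    refine Finset.disjoint_left.2 fun u hu hu' => ?_
    simp only [Finset.mem_inter, Finset.mem_sdiff, Finset.mem_toLeft] at hu hu'
    refine hu.1.2 (hXY (Finset.mem_inter.2 ⟨?_, ?_⟩))
    · simpa using hS hu.1.1
    · simpa using hS' hu'.1.1
  · rfl

/-! ## Correctness -/

theorem mem_leaf {l : List (Fin n)} {s : St n L m} :
    s ∈ d.leaf b l ↔ ∃ S, S ⊆ l.toFinset ∧ d.Valid b S ∧ s = d.sig b S := by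
  -- At a leaf nothing has been forgotten.
  have hsig : ∀ S, S ⊆ b.toLeft → d.sig b S = (S, 0, ∅) := fun S hS => by
    simp only [sig, Finset.sdiff_eq_empty_iff_subset.2 hS, Finset.inter_eq_left.2 hS,
      Finset.empty_inter, Finset.card_empty, ite_self, hits]
    simp; rfl
  induction l generalizing s with
  | nil =>
    simp only [leaf, List.foldr_nil, List.mem_singleton, List.toFinset_nil, Finset.subset_empty,
      exists_eq_left]
    rw [hsig ∅ (Finset.empty_subset _), iff_and_self]
    exact fun _ => ⟨Finset.empty_subset _, by simp⟩
  | cons i l ih =>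
    have : d.leaf b (i :: l) = d.step b (b.toLeft ∩ {i}) (d.leaf b l) := rfl
    have hupd : ∀ S, S ⊆ b.toLeft → d.upd b (S, 0, ∅) = d.sig b S := fun S hS => by
      rw [hsig S hS]
      simp only [upd, Finset.sdiff_eq_empty_iff_subset.2 hS, Finset.inter_eq_left.2 hS,
        Finset.empty_inter, Finset.card_empty, hits]
      simp; rfl
    rw [this, mem_step]
    constructor
    · rintro ⟨s', hs', D, hD, rfl, hok⟩
      obtain ⟨S, hSl, hS, rfl⟩ := ih.1 hs'
      have hDe : D ⊆ b.toLeft ∩ {i} := by rcases hD with rfl | rfl <;> simp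
      have hSD : S ∪ D ⊆ b.toLeft :=
        Finset.union_subset hS.1 (hDe.trans Finset.inter_subset_left)
      rw [hsig S hS.1] at hok ⊢
      rw [hupd _ hSD] at hok ⊢
      refine ⟨_, ?_, ⟨hSD, (ok_sig d b _).1 hok⟩, rfl⟩
      rw [List.toFinset_cons]
      refine Finset.union_subset (hSl.trans (Finset.subset_insert _ _)) fun u hu => ?_
      have := hDe hu
      simp only [Finset.mem_inter, Finset.mem_singleton] at this
      simp [this.2]
    · rintro ⟨S, hSl, hS, rfl⟩
      have hsub : S ∩ l.toFinset ⊆ S := Finset.inter_subset_left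
      refine ⟨_, ih.2 ⟨S ∩ l.toFinset, Finset.inter_subset_right,
        hS.mono subset_rfl hsub (hsub.trans hS.1), rfl⟩, S ∩ {i}, ?_, ?_, hS.ok subset_rfl⟩
      · by_cases hi : i ∈ S
        · right
          have : i ∈ b.toLeft := hS.1 hi
          rw [Finset.inter_singleton_of_mem hi, Finset.inter_singleton_of_mem this]
        · left; rw [Finset.inter_singleton_of_notMem hi]
      · rw [hsig _ (hsub.trans hS.1)]
        have : S ∩ l.toFinset ∪ S ∩ {i} = S := by
          rw [← Finset.inter_union_distrib_left, Finset.inter_eq_left]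
          intro u hu
          have := hSl hu
          simp only [List.toFinset_cons, Finset.mem_insert] at this
          simp only [Finset.mem_union, Finset.mem_singleton]
          tauto
        simp only [this, hupd S hS.1]

theorem nodup_leaf (l : List (Fin n)) : (d.leaf b l).Nodup := by
  cases l with
  | nil => exact List.nodup_singleton _
  | cons i l => exact d.nodup_step _ _ _

theorem nodup_solve (t : BagTree (Fin n ⊕ Fin L)) : (d.solve t).Nodup := by
  cases t with
  | leaf b => exact nodup_leaf _
  | one b t => exact d.nodup_step _ _ _
  | two b t t' => exact d.nodup_join _ _ _

/-- Induction on the tree. Soundness glues partial solutions of the children; completeness restricts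
a partial solution to the vertices of each child and recovers it as the union of these restrictions
and, at a node with one child, of its new elements. -/
theorem mem_solve {t : BagTree (Fin n ⊕ Fin L)} (h : d.Good t) {s : St n L m} :
    s ∈ d.solve t ↔ ∃ S, d.Valid t.verts S ∧ s = d.sig t.rootBag S := by
  induction t generalizing s with
  | leaf b =>
    simp only [solve, mem_leaf, BagTree.verts, BagTree.rootBag]
    refine exists_congr fun S => ?_
    simp [Finset.subset_iff]
  | one b t ih =>
    obtain ⟨ha, hc, hg⟩ := h
    simp only [solve, mem_step, BagTree.verts]
    constructor
    · rintro ⟨s', hs', D, hD, rfl, hok⟩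
      obtain ⟨S, hS, rfl⟩ := (ih hg).1 hs'
      have hDe : D ⊆ b.toLeft \ t.rootBag.toLeft := by rcases hD with rfl | rfl <;> simp
      rw [ha.upd_sig hS.1 hDe] at hok ⊢
      exact ⟨_, ha.valid_union hS hDe hok, rfl⟩
    · rintro ⟨S, hS, rfl⟩
      have hSX : d.Valid t.verts (S ∩ t.verts.toLeft) :=
        hS.mono Finset.subset_union_right Finset.inter_subset_left Finset.inter_subset_right
      have hD : S ∩ (b.toLeft \ t.rootBag.toLeft) ⊆ b.toLeft \ t.rootBag.toLeft :=
        Finset.inter_subset_right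
      refine ⟨_, (ih hg).2 ⟨_, hSX, rfl⟩, S ∩ (b.toLeft \ t.rootBag.toLeft), ?_, ?_,
        hS.ok Finset.subset_union_left⟩
      · rcases Finset.eq_empty_or_nonempty (S ∩ (b.toLeft \ t.rootBag.toLeft)) with h0 | h0
        · exact .inl h0
        · exact .inr (Finset.eq_of_subset_of_card_le hD (hc.trans h0.card_pos))
      · rw [ha.upd_sig hSX.1 hD, BagTree.rootBag]
        congr 1
        rw [← Finset.inter_union_distrib_left, eq_comm, Finset.inter_eq_left]
        intro u hu
        have := hS.1 hu
        have h' := t.rootBag_subset_verts (x := Sum.inl u)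
        simp only [Finset.mem_toLeft, Finset.mem_union, Finset.mem_sdiff] at this ⊢
        tauto
  | two b t t' ih ih' =>
    obtain ⟨ha, ha', hb, hb', hi, hg, hg'⟩ := h
    simp only [solve, mem_join, BagTree.verts]
    constructor
    · rintro ⟨s₁, hs₁, s₂, hs₂, h₁₂, rfl, hok⟩
      obtain ⟨S, hS, rfl⟩ := (ih hg).1 hs₁
      obtain ⟨S', hS', rfl⟩ := (ih' hg').1 hs₂
      rw [hb, hb'] at *
      rw [merge_sig hi hS.1 hS'.1 h₁₂] at hok ⊢
      refine ⟨S ∪ S', ⟨?_, fun j hj => ?_⟩, rfl⟩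
      · intro u hu
        have h₁ := @hS.1 u; have h₂ := @hS'.1 u
        simp only [Finset.mem_union, Finset.mem_toLeft] at *
        tauto
      · by_cases hjb : j ∈ b.toRight
        · exact (ok_sig d b _).1 hok j hjb
        -- A set `j` outside the bag gets nothing new from the other side: an element of `W_j` there
        -- outside `b` would put `j` into both subtrees, hence into `b`. Elements in `b` are chosen
        -- on both sides.
        have key : ∀ {X X' : BagTree (Fin n ⊕ Fin L)} {A A' : Finset (Fin n)}, d.Attach b X' →
            X.verts ∩ X'.verts ⊆ b → A' ⊆ X'.verts.toLeft → A ∩ b.toLeft = A' ∩ b.toLeft →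
            Sum.inr j ∈ X.verts → (A ∪ A') ∩ d.W j ⊆ A ∩ d.W j := by
          intro X X' A A' hX' hXX' hA' hAA' hj u hu
          simp only [Finset.mem_inter, Finset.mem_union] at hu ⊢
          refine ⟨hu.1.elim id fun hu' => ?_, hu.2⟩
          by_cases hub : u ∈ b.toLeft
          · exact (Finset.mem_inter.1 (hAA' ▸ Finset.mem_inter.2 ⟨hu', hub⟩)).1
          · refine absurd (Finset.mem_toRight.2 (hXX' (Finset.mem_inter.2 ⟨hj, ?_⟩))) hjb
            exact hX'.right u j hu.2 (by simpa using hA' hu') (by simpa using hub)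
        simp only [Finset.mem_toRight, Finset.mem_union] at hj hjb
        rcases hj with hj | hj | hj
        · exact absurd hj hjb
        · exact (Finset.card_le_card (key ha' hi hS'.1 h₁₂ hj)).trans (hS.2 j (by simpa using hj))
        · rw [Finset.union_comm]
          exact (Finset.card_le_card (key ha (by rwa [Finset.inter_comm]) hS.1 h₁₂.symm hj)).trans
            (hS'.2 j (by simpa using hj))
    · rintro ⟨S, hS, rfl⟩
      have hV : d.Valid t.verts (S ∩ t.verts.toLeft) :=
        hS.mono (Finset.subset_union_left.trans Finset.subset_union_right)
          Finset.inter_subset_left Finset.inter_subset_right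
      have hV' : d.Valid t'.verts (S ∩ t'.verts.toLeft) :=
        hS.mono (Finset.subset_union_right.trans Finset.subset_union_right)
          Finset.inter_subset_left Finset.inter_subset_right
      have hbt := t.rootBag_subset_verts
      have hbt' := t'.rootBag_subset_verts
      rw [hb] at hbt
      rw [hb'] at hbt'
      have h₁₂ : S ∩ t.verts.toLeft ∩ b.toLeft = S ∩ t'.verts.toLeft ∩ b.toLeft := by
        ext u
        have := @hbt (.inl u); have := @hbt' (.inl u)
        simp only [Finset.mem_inter, Finset.mem_toLeft]
        tauto
      refine ⟨_, (ih hg).2 ⟨_, hV, rfl⟩, _, (ih' hg').2 ⟨_, hV', rfl⟩, ?_, ?_,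
        hS.ok Finset.subset_union_left⟩
      · rw [hb, hb']; exact h₁₂
      · rw [hb, hb', merge_sig hi hV.1 hV'.1 h₁₂, BagTree.rootBag]
        congr 1
        rw [← Finset.inter_union_distrib_left, eq_comm, Finset.inter_eq_left]
        intro u hu
        have := hS.1 hu
        have := @hbt (.inl u)
        simp only [Finset.mem_toLeft, Finset.mem_union] at *
        tauto

end Dat

end FairHS

/-! ### Separation properties of rooted tree decompositions -/

namespace FairHS

namespace BagTree

variable {V : Type*}

theorem subtree?_append (t : BagTree V) (p q : List Bool) :
    t.subtree? (p ++ q) = (t.subtree? p).bind fun s => s.subtree? q := by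
  induction p generalizing t with
  | nil => simp [subtree?]
  | cons c p ih =>
    cases t <;> cases c <;> simp [subtree?, ih]

variable [DecidableEq V]

theorem mem_verts {t : BagTree V} {v : V} :
    v ∈ t.verts ↔ ∃ q s, t.subtree? q = some s ∧ v ∈ s.rootBag := by
  constructor
  · intro h
    induction t with
    | leaf b => exact ⟨[], _, rfl, h⟩
    | one b t ih =>
      rcases Finset.mem_union.1 h with h | h
      · exact ⟨[], _, rfl, h⟩
      · obtain ⟨q, s, hs, hv⟩ := ih h
        exact ⟨false :: q, s, hs, hv⟩
    | two b t t' ih ih' =>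
      simp only [verts, Finset.mem_union] at h
      rcases h with h | h | h
      · exact ⟨[], _, rfl, h⟩
      · obtain ⟨q, s, hs, hv⟩ := ih h
        exact ⟨false :: q, s, hs, hv⟩
      · obtain ⟨q, s, hs, hv⟩ := ih' h
        exact ⟨true :: q, s, hs, hv⟩
  · rintro ⟨q, s, hs, hv⟩
    induction q generalizing t with
    | nil =>
      obtain rfl : t = s := by simpa [subtree?] using hs
      exact t.rootBag_subset_verts hv
    | cons c q ih =>
      cases t with
      | leaf b => simp [subtree?] at hs
      | one b t =>
        cases c with
        | false => exact Finset.mem_union_right _ (ih hs)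
        | true => simp [subtree?] at hs
      | two b t t' =>
        cases c with
        | false => exact Finset.mem_union_right _ (Finset.mem_union_left _ (ih hs))
        | true => exact Finset.mem_union_right _ (Finset.mem_union_right _ (ih hs))

theorem mem_verts_subtree {t s : BagTree V} {p : List Bool} (hs : t.subtree? p = some s) {v : V} :
    v ∈ s.verts ↔ ∃ x : t.Node, p <+: x.1 ∧ v ∈ t.bag x := by
  rw [mem_verts]
  constructor
  · rintro ⟨q, s', hs', hv⟩
    have h : t.subtree? (p ++ q) = some s' := by rw [subtree?_append, hs]; exact hs'
    exact ⟨⟨p ++ q, by rw [h]; rfl⟩, List.prefix_append _ _, by simpa [bag, h] using hv⟩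
  · rintro ⟨⟨_, hx⟩, ⟨q, rfl⟩, hv⟩
    obtain ⟨s', hs'⟩ := Option.isSome_iff_exists.1 hx
    refine ⟨q, s', ?_, by simpa [bag, hs'] using hv⟩
    rw [subtree?_append, hs] at hs'
    exact hs'

omit [DecidableEq V] in
/-- A set of nodes that is connected and meets both the subtree below an edge and its complement
contains both ends of that edge. -/
theorem mem_of_connected {G : SimpleGraph V} {t : BagTree V}
    (ht : IsTreeDecomposition G t.graph t.bag) {v : V} {p : List Bool} {c : Bool} {x y : t.Node}
    (hx : p ++ [c] <+: x.1) (hy : ¬ p ++ [c] <+: y.1) (hvx : v ∈ t.bag x) (hvy : v ∈ t.bag y) :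
    (∃ z : t.Node, z.1 = p ∧ v ∈ t.bag z) ∧ ∃ z : t.Node, z.1 = p ++ [c] ∧ v ∈ t.bag z := by
  obtain ⟨w⟩ := (ht.connected v).preconnected ⟨x, hvx⟩ ⟨y, hvy⟩
  -- A walk among the nodes containing `v` leaves the set of addresses extending `p ++ [c]`; the
  -- only edge doing so joins `p ++ [c]` to its parent `p`.
  obtain ⟨a, _, ha, ha'⟩ := w.exists_boundary_dart {z | p ++ [c] <+: z.1.1} hx hy
  have hadj := a.adj
  rw [SimpleGraph.induce_adj] at hadj
  simp only [graph, SimpleGraph.fromRel_adj] at hadj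
  simp only [Set.mem_ofPred_eq] at ha ha'
  obtain ⟨_, ⟨c', h⟩ | ⟨c', h⟩⟩ := hadj
  · rw [h] at ha'
    exact absurd (ha.trans (List.prefix_append _ _)) ha'
  · rw [h, List.prefix_concat_iff] at ha
    rcases ha with ha | ha
    · obtain ⟨h₁, -⟩ := List.append_inj' ha rfl
      exact ⟨⟨a.snd.1, h₁.symm, a.snd.2⟩, ⟨a.fst.1, h.trans ha.symm, a.fst.2⟩⟩
    · exact absurd ha ha'

/-- A child subtree `t` of a node with bag `b` is separated from the outside by `b`. -/
def Separated (G : SimpleGraph V) (b : Finset V) (t : BagTree V) : Prop :=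
  (∀ v ∈ t.verts, v ∈ b → v ∈ t.rootBag) ∧
    ∀ v w, G.Adj v w → v ∈ t.verts → v ∉ b → w ∈ t.verts

def Layered (G : SimpleGraph V) : BagTree V → Prop
  | leaf _ => True
  | one b t => Separated G b t ∧ t.Layered G
  | two b t t' => Separated G b t ∧ Separated G b t' ∧ t.verts ∩ t'.verts ⊆ b ∧
      t.Layered G ∧ t'.Layered G

/-- A vertex with bags both inside and outside the child's subtree lies in both bags at the
connecting edge. For an edge `vw`, a bag containing it lies inside the subtree, or else `v` occurs
on both sides and is in the parent's bag. -/
theorem separated_child {G : SimpleGraph V} {t s s' : BagTree V} {p : List Bool} {c : Bool}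
    (ht : IsTreeDecomposition G t.graph t.bag) (hs : t.subtree? p = some s)
    (hs' : t.subtree? (p ++ [c]) = some s') : Separated G s.rootBag s' := by
  have hp : ¬ p ++ [c] <+: p := fun h => by simpa using h.length_le
  constructor
  · intro v hv hvb
    obtain ⟨x, hx, hvx⟩ := (mem_verts_subtree hs').1 hv
    obtain ⟨-, ⟨_, hz⟩, rfl, hvz⟩ := mem_of_connected ht (y := ⟨p, by rw [hs]; rfl⟩) hx hp hvx
      (by simpa [bag, hs] using hvb)
    simpa [bag, hs'] using hvz
  · intro v w hvw hv hvb
    obtain ⟨y, hvy, hwy⟩ := ht.edge v w hvw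
    by_cases hy : p ++ [c] <+: y.1
    · exact (mem_verts_subtree hs').2 ⟨y, hy, hwy⟩
    · obtain ⟨x, hx, hvx⟩ := (mem_verts_subtree hs').1 hv
      obtain ⟨⟨⟨_, hz⟩, rfl, hvz⟩, -⟩ := mem_of_connected ht hx hy hvx hvy
      exact absurd (by simpa [bag, hs] using hvz) hvb

theorem layered {G : SimpleGraph V} {t : BagTree V} (ht : IsTreeDecomposition G t.graph t.bag)
    (s : BagTree V) (p : List Bool) (hs : t.subtree? p = some s) : s.Layered G := by
  induction s generalizing p with
  | leaf b => trivial
  | one b s ih =>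
    have h : t.subtree? (p ++ [false]) = some s := by rw [subtree?_append, hs]; simp [subtree?]
    exact ⟨separated_child ht hs h, ih _ h⟩
  | two b s s' ih ih' =>
    have h : t.subtree? (p ++ [false]) = some s := by rw [subtree?_append, hs]; simp [subtree?]
    have h' : t.subtree? (p ++ [true]) = some s' := by rw [subtree?_append, hs]; simp [subtree?]
    refine ⟨separated_child ht hs h, separated_child ht hs h', fun v hv => ?_, ih _ h, ih' _ h'⟩
    obtain ⟨hv, hv'⟩ := Finset.mem_inter.1 hv
    obtain ⟨x, hx, hvx⟩ := (mem_verts_subtree h).1 hv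
    obtain ⟨y, hy, hvy⟩ := (mem_verts_subtree h').1 hv'
    have hy' : ¬ p ++ [false] <+: y.1 := fun h => by
      have := List.prefix_of_prefix_length_le h hy (by simp)
      simp at this
    obtain ⟨⟨⟨_, hz⟩, rfl, hvz⟩, -⟩ := mem_of_connected ht hx hy' hvx hvy
    simpa [bag, hs, rootBag] using hvz

theorem verts_map {V' : Type*} [DecidableEq V'] {f : Finset V → Finset V'} {v : V} {v' : V'}
    (h : ∀ b, v' ∈ f b ↔ v ∈ b) (t : BagTree V) : v' ∈ (t.map f).verts ↔ v ∈ t.verts := by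
  induction t with
  | leaf b => exact h b
  | one b t ih => simp only [map, verts, Finset.mem_union, h, ih]
  | two b t t' ih ih' => simp only [map, verts, Finset.mem_union, h, ih, ih']

end BagTree

/-! ### The augmented decomposition and the answer at the root -/

variable {n l : ℕ}

theorem inl_mem_augBag {u : Fin n} (b : Finset (Fin n ⊕ Fin l)) :
    Sum.inl u ∈ augBag b ↔ Sum.inl u ∈ b := by
  simp [augBag]

theorem inr_zero_mem_augBag (b : Finset (Fin n ⊕ Fin l)) :
    Sum.inr 0 ∈ augBag b := by
  simp [augBag]

theorem inr_succ_mem_augBag {j : Fin l} (b : Finset (Fin n ⊕ Fin l)) :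
    Sum.inr j.succ ∈ augBag b ↔ Sum.inr j ∈ b := by
  simp [augBag, Fin.succ_ne_zero]

theorem inr_zero_mem_verts (t : BagTree (Fin n ⊕ Fin l)) :
    Sum.inr 0 ∈ (t.map augBag).verts := by
  refine BagTree.rootBag_subset_verts _ ?_
  rw [BagTree.rootBag_map]; exact inr_zero_mem_augBag _

theorem Instance.incidenceGraph_adj (I : Instance) {u : Fin I.n} {j : Fin I.l} (h : u ∈ I.B j) :
    I.incidenceGraph.Adj (.inl u) (.inr j) := by
  rw [incidenceGraph, SimpleGraph.fromRel_adj]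
  exact ⟨by simp, .inl ⟨u, j, rfl, rfl, h⟩⟩

/-- The budget set is in every bag, which settles its conditions; the others are the separation
property applied to edges of the incidence graph. -/
theorem Instance.attach (I : Instance) {b : Finset (Fin I.n ⊕ Fin I.l)}
    {t : BagTree (Fin I.n ⊕ Fin I.l)} (h : t.Separated I.incidenceGraph b) :
    I.dat.Attach (augBag b) (t.map augBag) := by
  constructor
  · rintro (u | j) hv hb
    · rw [BagTree.rootBag_map, inl_mem_augBag]
      exact h.1 _ ((BagTree.verts_map inl_mem_augBag t).1 hv) ((inl_mem_augBag b).1 hb)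
    · rw [BagTree.rootBag_map]
      cases j using Fin.cases with
      | zero => exact inr_zero_mem_augBag _
      | succ j =>
        rw [inr_succ_mem_augBag]
        exact h.1 _ ((BagTree.verts_map inr_succ_mem_augBag t).1 hv)
          ((inr_succ_mem_augBag b).1 hb)
  · intro u j hu hv hb
    cases j using Fin.cases with
    | zero => exact inr_zero_mem_verts t
    | succ j =>
      rw [BagTree.verts_map inr_succ_mem_augBag]
      exact h.2 _ _ (I.incidenceGraph_adj hu) ((BagTree.verts_map inl_mem_augBag t).1 hv)
        (mt (inl_mem_augBag b).2 hb)
  · intro u j hu hv hb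
    cases j using Fin.cases with
    | zero => exact absurd (inr_zero_mem_augBag b) hb
    | succ j =>
      rw [BagTree.verts_map inl_mem_augBag]
      exact h.2 _ _ (I.incidenceGraph_adj hu).symm
        ((BagTree.verts_map inr_succ_mem_augBag t).1 hv) (mt (inr_succ_mem_augBag b).2 hb)

theorem Instance.good (I : Instance) {t : BagTree (Fin I.n ⊕ Fin I.l)}
    (h : t.Layered I.incidenceGraph) (hn : t.NodesNice) : I.dat.Good (t.map augBag) := by
  induction t with
  | leaf b => trivial
  | one b t ih =>
    refine ⟨I.attach h.1, ?_, ih h.2 hn.2⟩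
    have hsub : ∃ v, ∀ w ∈ b, w ∉ t.rootBag → w = v := by
      rcases hn.1 with ⟨v, -, rfl⟩ | ⟨v, -, rfl⟩
      · exact ⟨v, fun w hw hw' => (Finset.mem_insert.1 hw).resolve_right hw'⟩
      · exact ⟨v, fun w hw hw' => absurd (Finset.mem_of_mem_erase hw) hw'⟩
    obtain ⟨v, hv⟩ := hsub
    rw [Finset.card_le_one]
    intro u hu u' hu'
    simp only [BagTree.rootBag_map, Finset.mem_sdiff, Finset.mem_toLeft, inl_mem_augBag] at hu hu'
    exact Sum.inl_injective ((hv _ hu.1 hu.2).trans (hv _ hu'.1 hu'.2).symm)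
  | two b t t' ih ih' =>
    obtain ⟨hb, hb', hn, hn'⟩ := hn
    obtain ⟨hs, hs', hi, hl, hl'⟩ := h
    refine ⟨I.attach hs, I.attach hs', by rw [BagTree.rootBag_map, hb],
      by rw [BagTree.rootBag_map, hb'], ?_, ih hl hn, ih' hl' hn'⟩
    rintro (u | j) hv
    · rw [Finset.mem_inter, BagTree.verts_map inl_mem_augBag,
        BagTree.verts_map inl_mem_augBag, ← Finset.mem_inter] at hv
      exact (inl_mem_augBag b).2 (hi hv)
    · cases j using Fin.cases with
      | zero => exact inr_zero_mem_augBag b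
      | succ j =>
        rw [Finset.mem_inter, BagTree.verts_map inr_succ_mem_augBag,
          BagTree.verts_map inr_succ_mem_augBag, ← Finset.mem_inter] at hv
        exact (inr_succ_mem_augBag b).2 (hi hv)

theorem Instance.isYes_iff (I : Instance) {T : BagTree (Fin I.n ⊕ Fin I.l)}
    (hT : T.IsNiceTreeDecomposition I.incidenceGraph) :
    (∃ s ∈ I.dat.solve (T.map augBag), s.2.2 = Finset.univ) ↔ I.IsYes := by
  obtain ⟨ht, hr, hn⟩ := hT
  have hg := I.good (BagTree.layered ht T [] (by simp [BagTree.subtree?])) hn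
  have hv (v) : v ∈ T.verts := by
    obtain ⟨x, hx⟩ := ht.cover v
    exact (BagTree.mem_verts_subtree (t := T) (p := []) (by simp [BagTree.subtree?])).2 ⟨x, List.nil_prefix, hx⟩
  -- No element is left in the root bag, so all of `S` is forgotten and the hit family in its state
  -- is complete.
  have hroot : (T.map augBag).rootBag.toLeft = ∅ := by
    rw [BagTree.rootBag_map, hr]; ext; simp [augBag]
  simp only [Dat.mem_solve hg]
  constructor
  · rintro ⟨_, ⟨S, ⟨-, hS⟩, rfl⟩, hc⟩
    refine ⟨S, ?_, fun i => ?_, fun j => ?_⟩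
    · simpa [Instance.dat] using hS 0 (Finset.mem_toRight.2 (inr_zero_mem_verts T))
    · have := Finset.eq_univ_iff_forall.1 hc i
      simpa [Dat.sig, hroot, Dat.hits, Instance.dat] using this
    · exact hS j.succ (Finset.mem_toRight.2 ((BagTree.verts_map inr_succ_mem_augBag T).2 (hv _)))
  · rintro ⟨S, hk, hF, hB⟩
    refine ⟨_, ⟨S, ⟨fun u _ => ?_, fun j _ => ?_⟩, rfl⟩, ?_⟩
    · exact Finset.mem_toLeft.2 ((BagTree.verts_map inl_mem_augBag T).2 (hv _))
    · cases j using Fin.cases with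
      | zero => simpa [Instance.dat] using hk
      | succ j => exact hB j
    · rw [Finset.eq_univ_iff_forall]
      intro i
      simpa [Dat.sig, hroot, Dat.hits, Instance.dat] using hF i

end FairHS

namespace FairHS

/-! ## The number of states -/

section Count

variable {n L m : ℕ} {d : Dat n L m}

theorem Dat.sig_le (b : Bag n L) (S : Finset (Fin n)) (j : Fin L) : (d.sig b S).2.1 j ≤ S.card := by
  simp only [Dat.sig]
  split_ifs
  · exact Finset.card_le_card (Finset.inter_subset_left.trans Finset.sdiff_subset)
  · exact Nat.zero_le _

theorem card_subsets_le_one (n : ℕ) :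
    (Finset.univ.filter fun S : Finset (Fin n) => S.card ≤ 1).card ≤ n + 1 := by
  have : (Finset.univ.filter fun S : Finset (Fin n) => S.card ≤ 1) ⊆
      insert ∅ (Finset.univ.image fun i : Fin n => ({i} : Finset (Fin n))) := by
    intro S hS
    have hS := (Finset.mem_filter.1 hS).2
    rcases S.eq_empty_or_nonempty with rfl | ⟨i, hi⟩
    · exact Finset.mem_insert_self _ _
    · have : S = {i} := Finset.eq_singleton_iff_unique_mem.2
        ⟨hi, fun j hj => Finset.card_le_one.1 hS j hj i hi⟩
      exact Finset.mem_insert_of_mem (Finset.mem_image.2 ⟨i, Finset.mem_univ i, this.symm⟩)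
  refine (Finset.card_le_card this).trans ((Finset.card_insert_le _ _).trans ?_)
  exact Nat.succ_le_succ (Finset.card_image_le.trans (by simp))

/-- For `k ≥ 2` each of the at most `w + 2` bag vertices contributes a factor `q + 1` with `q = min
k n`: `w` of these factors are bounded by `k ^ 2`, the other two by `n + 1`. For `k = 1` powers of
`k` are no help, but there are only `n + 1` sets `S`. -/
theorem Dat.length_le_of_sig {k : ℕ} (hk : 0 < k) {b : Bag n L} {T : List (St n L m)}
    (hT : T.Nodup) (h : ∀ s ∈ T, ∃ S, S.card ≤ k ∧ s = d.sig b S) {w : ℕ} (hb : b.card ≤ w + 2) :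
    T.length ≤ k ^ (2 * w) * 2 ^ m * (n + 1) ^ 2 := by
  rw [← List.toFinset_card_of_nodup hT]
  rcases Nat.lt_or_ge 1 k with hk2 | hk1
  · set q := min k n with hq
    have hsub : T.toFinset ⊆ b.toLeft.powerset ×ˢ
        ((Fintype.piFinset fun j => if j ∈ b.toRight then Finset.range (q + 1) else {0}) ×ˢ
          (Finset.univ : Finset (Finset (Fin m)))) := by
      intro s hs
      obtain ⟨S, hS, rfl⟩ := h s (List.mem_toFinset.1 hs)
      have hSn : S.card ≤ n := by simpa using S.card_le_univ
      simp only [Finset.mem_product, Finset.mem_powerset, Fintype.mem_piFinset, Finset.mem_univ,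
        and_true]
      refine ⟨Finset.inter_subset_right, fun j => ?_⟩
      by_cases hj : j ∈ b.toRight
      · have := d.sig_le b S j
        rw [if_pos hj, Finset.mem_range]; omega
      · simp only [Dat.sig, if_neg hj, Finset.mem_singleton]
    refine (Finset.card_le_card hsub).trans ?_
    have hprod : ∏ j, (if j ∈ b.toRight then Finset.range (q + 1) else {0}).card =
        (q + 1) ^ b.toRight.card := by
      simp only [apply_ite Finset.card, Finset.card_range, Finset.card_singleton]
      rw [Finset.prod_ite_mem, Finset.univ_inter, Finset.prod_const]
    rw [Finset.card_product, Finset.card_product, Finset.card_powerset, Fintype.card_piFinset,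
      hprod, Finset.card_univ, Fintype.card_finset, Fintype.card_fin]
    -- `q = 0` happens only for an empty universe, where the exponent is zero.
    have h2 : 2 ^ b.toLeft.card ≤ (q + 1) ^ b.toLeft.card := by
      rcases Nat.eq_zero_or_pos n with rfl | hn
      · have : b.toLeft.card = 0 := by simpa using b.toLeft.card_le_univ
        simp [this]
      · exact Nat.pow_le_pow_left (by omega) _
    calc 2 ^ b.toLeft.card * ((q + 1) ^ b.toRight.card * 2 ^ m)
        ≤ (q + 1) ^ b.toLeft.card * ((q + 1) ^ b.toRight.card * 2 ^ m) := by gcongr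
      _ = (q + 1) ^ b.card * 2 ^ m := by
          rw [← Finset.card_toLeft_add_card_toRight (u := b)]; ring
      _ ≤ (q + 1) ^ (w + 2) * 2 ^ m := by gcongr; omega
      _ = (q + 1) ^ w * 2 ^ m * (q + 1) ^ 2 := by ring
      _ ≤ (k ^ 2) ^ w * 2 ^ m * (n + 1) ^ 2 := by
          have : q + 1 ≤ k ^ 2 := by
            have : q ≤ k := min_le_left _ _
            nlinarith
          have : q ≤ n := min_le_right _ _
          gcongr
      _ = k ^ (2 * w) * 2 ^ m * (n + 1) ^ 2 := by rw [pow_mul]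
  · have hsub : T.toFinset ⊆
        (Finset.univ.filter fun S : Finset (Fin n) => S.card ≤ 1).image (d.sig b) := by
      intro s hs
      obtain ⟨S, hS, rfl⟩ := h s (List.mem_toFinset.1 hs)
      exact Finset.mem_image_of_mem _ (by simpa using hS.trans hk1)
    calc T.toFinset.card ≤ n + 1 :=
          ((Finset.card_le_card hsub).trans Finset.card_image_le).trans (card_subsets_le_one n)
      _ ≤ (n + 1) ^ 2 := Nat.le_self_pow (by norm_num) _
      _ ≤ k ^ (2 * w) * 2 ^ m * (n + 1) ^ 2 :=
          Nat.le_mul_of_pos_left _ (by positivity)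

end Count

theorem card_augBag {n l : ℕ} (b : Finset (Fin n ⊕ Fin l)) : (augBag b).card = b.card + 1 := by
  rw [augBag, Finset.card_disjSum, Finset.card_insert_of_notMem (by simp [Fin.succ_ne_zero]),
    Finset.card_map, ← Finset.card_toLeft_add_card_toRight (u := b), add_assoc]

/-- Every vertex set in play contains the budget vertex, so the partial solutions behind the states
have at most `k` elements. That vertex raises the bag size from `w + 1` to `w + 2`. -/
theorem Instance.small (I : Instance) {w : ℕ} {t : BagTree (Fin I.n ⊕ Fin I.l)}
    (ht : t.maxBagCard ≤ w + 1) (hg : I.dat.Good (t.map augBag)) :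
    Small I.dat I.n (I.k ^ (2 * w) * 2 ^ I.m * (I.n + 1) ^ 2) (t.map augBag) := by
  have key (b : Finset (Fin I.n ⊕ Fin I.l)) (hb : b.card ≤ w + 1)
      (T : List (St I.n (I.l + 1) I.m)) (hT : T.Nodup)
      (h : ∀ s ∈ T, ∃ X S, .inr 0 ∈ X ∧ I.dat.Valid X S ∧ s = I.dat.sig (augBag b) S) :
      T.length ≤ I.k ^ (2 * w) * 2 ^ I.m * (I.n + 1) ^ 2 ∧ ∀ s ∈ T, ∀ j, s.2.1 j ≤ I.n := by
    constructor
    · refine Dat.length_le_of_sig (d := I.dat) I.k_pos hT (b := augBag b) (fun s hs => ?_)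
        (by rw [card_augBag]; omega)
      obtain ⟨X, S, hX, hS, rfl⟩ := h s hs
      exact ⟨S, by simpa [Instance.dat] using hS.2 0 (Finset.mem_toRight.2 hX), rfl⟩
    · intro s hs j
      obtain ⟨X, S, -, -, rfl⟩ := h s hs
      exact (Dat.sig_le _ _ _).trans (by simpa using S.card_le_univ)
  have node (t : BagTree (Fin I.n ⊕ Fin I.l)) (hb : t.rootBag.card ≤ w + 1)
      (hg : I.dat.Good (t.map augBag)) :=
    key t.rootBag hb (I.dat.solve (t.map augBag)) (Dat.nodup_solve _) fun s hs => by
      obtain ⟨S, hS, rfl⟩ := (Dat.mem_solve hg).1 hs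
      exact ⟨_, S, inr_zero_mem_verts t, hS, by rw [BagTree.rootBag_map]⟩
  induction t with
  | leaf b =>
    intro l _
    refine key b ht _ (Dat.nodup_leaf _) fun s hs => ?_
    obtain ⟨S, -, hS, rfl⟩ := Dat.mem_leaf.1 hs
    exact ⟨_, S, inr_zero_mem_augBag b, hS, rfl⟩
  | one b t ih =>
    obtain ⟨hb, ht⟩ := max_le_iff.1 ht
    exact ⟨ih ht hg.2.2, node (.one b t) hb hg⟩
  | two b t t' ih ih' =>
    obtain ⟨hb, ht⟩ := max_le_iff.1 ht
    obtain ⟨ht, ht'⟩ := max_le_iff.1 ht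
    exact ⟨ih ht hg.2.2.2.2.2.1, ih' ht' hg.2.2.2.2.2.2, node (.two b t t') hb hg⟩

/-! ## Polynomial bounds -/

/-- `f` is bounded by a polynomial in the three parameters. -/
def PolyBounded (f : ℕ → ℕ → ℕ → ℕ) : Prop :=
  ∃ C, ∀ q M N, f q M N ≤ C * ((q + 1) * (M + 1) * (N + 1)) ^ C

namespace PolyBounded

variable {f g : ℕ → ℕ → ℕ → ℕ}

theorem const (c : ℕ) : PolyBounded fun _ _ _ => c :=
  ⟨c, fun q M N => Nat.le_mul_of_pos_right _ (by positivity)⟩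

theorem of_le (h : ∀ q M N, f q M N ≤ (q + 1) * (M + 1) * (N + 1)) : PolyBounded f :=
  ⟨1, fun q M N => by simpa using h q M N⟩

theorem fst : PolyBounded fun q _ _ => q := of_le fun q M N => by
  rw [mul_assoc]; exact (Nat.le_succ q).trans (Nat.le_mul_of_pos_right _ (by positivity))

theorem snd : PolyBounded fun _ M _ => M := of_le fun q M N => by
  rw [mul_right_comm]; exact (Nat.le_succ M).trans (Nat.le_mul_of_pos_left _ (by positivity))

theorem thd : PolyBounded fun _ _ N => N := of_le fun q M N =>
  (Nat.le_succ N).trans (Nat.le_mul_of_pos_left _ (by positivity))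

theorem add (hf : PolyBounded f) (hg : PolyBounded g) :
    PolyBounded fun q M N => f q M N + g q M N := by
  obtain ⟨C, hC⟩ := hf
  obtain ⟨C', hC'⟩ := hg
  refine ⟨C + C', fun q M N => ?_⟩
  have hX : 1 ≤ (q + 1) * (M + 1) * (N + 1) := Nat.pos_of_ne_zero (by positivity)
  rw [Nat.add_mul]
  exact Nat.add_le_add
    ((hC q M N).trans (Nat.mul_le_mul_left _ (Nat.pow_le_pow_right hX (Nat.le_add_right _ _))))
    ((hC' q M N).trans (Nat.mul_le_mul_left _ (Nat.pow_le_pow_right hX (Nat.le_add_left _ _))))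

theorem mul (hf : PolyBounded f) (hg : PolyBounded g) :
    PolyBounded fun q M N => f q M N * g q M N := by
  obtain ⟨C, hC⟩ := hf
  obtain ⟨C', hC'⟩ := hg
  refine ⟨C * C' + (C + C'), fun q M N => ?_⟩
  have hX : 1 ≤ (q + 1) * (M + 1) * (N + 1) := Nat.pos_of_ne_zero (by positivity)
  calc f q M N * g q M N ≤ _ := Nat.mul_le_mul (hC q M N) (hC' q M N)
    _ = C * C' * ((q + 1) * (M + 1) * (N + 1)) ^ (C + C') := by ring
    _ ≤ _ := Nat.mul_le_mul (Nat.le_add_right _ _)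
        (Nat.pow_le_pow_right hX (Nat.le_add_left _ _))

theorem loop {h : ℕ → ℕ → ℕ → ℕ} (hf : PolyBounded f) (hg : PolyBounded g) (hh : PolyBounded h) :
    PolyBounded fun q M N => FairHS.loop (f q M N) (g q M N) (h q M N) :=
  ((hf.mul (hg.add (const 12))).add hh).add (const 12)

end PolyBounded

open PolyBounded in
theorem polyBounded_cMain : PolyBounded cMain := by
  have hApp : PolyBounded fun q _ _ => cApp q := fst.loop (const _) (const _)
  have hZip : PolyBounded fun q _ _ => cZipApp q := fst.loop (hApp.add (const _)) (const _)
  have hMask : PolyBounded fun q _ _ => cMask q := fst.loop (const _) (const _)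
  have hMinus : PolyBounded fun q _ _ => cMinus q := fst.loop (const _) (const _)
  have hCnt : PolyBounded fun q _ _ => cCnt q := fst.loop (const _) (const _)
  have hCnts : PolyBounded fun q _ _ => cCnts q := fst.loop (hCnt.add (const _)) (const _)
  have hTrunc : PolyBounded fun q _ _ => cTrunc q := fst.loop (const _) (const _)
  have hHalf : PolyBounded fun q _ _ => cHalf q := ((const 20).mul fst).add (const _)
  have hLeq : PolyBounded fun q _ _ => cLeqBits q := fst.loop (hHalf.add (const _)) (const _)
  have hAllLeq : PolyBounded fun q _ _ => cAllLeq q := fst.loop (hLeq.add (const _)) (const _)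
  have hWeight : PolyBounded fun q _ _ => cWeight q :=
    ((const 3).mul (fst.mul (((const 2).mul fst).add (const 2)))).add (const 5)
  have hVeq : PolyBounded fun q _ _ => cVeq (cWeight q) := (const 20).mul hWeight
  have hMem : PolyBounded fun q M _ => cMem (cWeight q) M := snd.loop (hVeq.add (const _)) (const _)
  have hMapCons : PolyBounded fun q _ _ => cMapCons q := fst.loop (const _) (const _)
  have hSingles : PolyBounded fun q _ _ => cSingles q :=
    fst.loop ((hMinus.add hMapCons).add (const _)) (const _)
  have hAllTrue : PolyBounded fun q _ _ => cAllTrue q := fst.loop (const _) (const _)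
  have hUpd : PolyBounded fun q _ _ => cUpd q :=
    ((((hMinus.add ((const 2).mul hMask)).add ((const 2).mul hCnts)).add
      ((const 2).mul hZip)).add hTrunc).add (const 100)
  have hCheck : PolyBounded fun q _ _ => cCheck q :=
    (((hCnts.add hZip).add hMask).add hAllLeq).add (const 100)
  have hIns : PolyBounded fun q M _ => cIns q M := (hCheck.add hMem).add (const 100)
  have hStep : PolyBounded fun q M _ => cStep q M :=
    snd.loop ((((((const 2).mul hIns).add ((const 2).mul hUpd)).add hTrunc).add hZip).add
      (const _)) (const _)
  have hLeaf : PolyBounded fun q M _ => cLeaf q M :=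
    fst.loop (hStep.add (const _)) ((hMinus.add ((const 2).mul hCnts)).add (const 100))
  have hJoinIn : PolyBounded fun q M _ => cJoinIn q M :=
    snd.loop ((((hVeq.add ((const 2).mul hZip)).add hTrunc).add hIns).add (const _)) (const _)
  have hJoin : PolyBounded fun q M _ => cJoin q M := snd.loop (hJoinIn.add (const _)) (const _)
  have hNode : PolyBounded fun q M _ => cNode q M :=
    ((((hSingles.add hLeaf).add hMinus).add hStep).add hJoin).add (const 100)
  have hAnyFull : PolyBounded fun q M _ => cAnyFull q M :=
    snd.loop (hAllTrue.add (const _)) (const _)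
  exact (((hTrunc.add ((const 3).mul hMapCons)).add (thd.mul hNode)).add hAnyFull).add (const 100)

/-- The factor `4` leaves room for `3 * n ≤ q`, required by `solve_spec`; the digits of `k` pay for
the additional set. -/
theorem Instance.bounded (I : Instance) : I.dat.Bounded (4 * I.size) ∧ I.n ≤ I.size ∧
    1 ≤ I.size := by
  have hk : 0 < I.k.size := Nat.size_pos.2 I.k_pos
  have hm : I.m ≤ ∑ i, ((I.F i).card + 1) := by
    have : I.m = ∑ _i : Fin I.m, 1 := by simp
    conv_lhs => rw [this]
    exact Finset.sum_le_sum fun i _ => Nat.le_add_left _ _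
  have hl : I.l ≤ ∑ j, ((I.B j).card + 1 + (I.cap j).size) := by
    have : I.l = ∑ _j : Fin I.l, 1 := by simp
    conv_lhs => rw [this]
    exact Finset.sum_le_sum fun j _ => by omega
  have hc (j : Fin I.l) : (I.cap j).size ≤ ∑ j, ((I.B j).card + 1 + (I.cap j).size) :=
    (Nat.le_add_left _ _).trans (Finset.single_le_sum
      (f := fun j => (I.B j).card + 1 + (I.cap j).size) (fun _ _ => Nat.zero_le _)
      (Finset.mem_univ j))
  refine ⟨⟨?_, ?_, ?_, ?_, fun j => ?_⟩, ?_, ?_⟩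
  all_goals unfold Instance.size
  any_goals omega
  cases j using Fin.cases with
  | zero => simp only [Instance.dat, Fin.cons_zero]; omega
  | succ j => have := hc j; simp only [Instance.dat, Fin.cons_succ]; omega

end FairHS

/-! ### The main theorem -/

theorem mainTheorem7 :
    ∃ (P : FairHS.Program) (c : ℕ),
      ∀ (I : FairHS.Instance) (T : FairHS.BagTree (Fin I.n ⊕ Fin I.l)),
        FairHS.BagTree.IsNiceTreeDecomposition I.incidenceGraph T →
        ∃ (answer : Bool) (time : ℕ),
          P.Runs (FairHS.Val.cons I.encode T.encode) (FairHS.Val.ofBool answer) time ∧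
          (answer = true ↔ I.IsYes) ∧
          time ≤ c * I.k ^ (c * T.width) * 2 ^ (c * I.m) * (I.size + T.numNodes) ^ c := by
  obtain ⟨C, hC⟩ := FairHS.polyBounded_cMain
  -- Large enough for the coefficient `C * 80 ^ C` and for the exponents `2 * C`, `C` and `4 * C`
  -- that arise at the end.
  refine ⟨FairHS.program, C * 80 ^ C + 4 * C, fun I T hT => ?_⟩
  obtain ⟨hd, hn, hs⟩ := I.bounded
  have hsmall := I.small (w := T.width) (t := T) (by unfold FairHS.BagTree.width; omega)
    (I.good (FairHS.BagTree.layered hT.1 T [] (by simp [FairHS.BagTree.subtree?])) hT.2.2)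
  obtain ⟨t, ht, hrun⟩ := FairHS.program_spec I T hd (by omega) hsmall
  refine ⟨_, t, hrun, by rw [decide_eq_true_iff]; exact I.isYes_iff hT, ht.trans ((hC _ _ _).trans ?_)⟩
  set s := I.size + T.numNodes with hs'
  set A := I.k ^ (2 * T.width) * 2 ^ I.m with hA
  have hk := I.k_pos
  have hA1 : 1 ≤ A := Nat.pos_of_ne_zero (by positivity)
  -- The three factors are at most `5s`, `8As²` and `2s`.
  have hX : (4 * I.size + 1) * (A * (I.n + 1) ^ 2 + 1) * (T.numNodes + 1) ≤ 80 * A * s ^ 4 := by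
    have h1 : 4 * I.size + 1 ≤ 5 * s := by omega
    have h2 : I.n + 1 ≤ 2 * s := by omega
    have h3 : T.numNodes + 1 ≤ 2 * s := by omega
    have h4 : A * (I.n + 1) ^ 2 + 1 ≤ 2 * (A * (2 * s) ^ 2) := by
      have : A * (I.n + 1) ^ 2 ≤ A * (2 * s) ^ 2 := by gcongr
      have : 1 ≤ A * (2 * s) ^ 2 := Nat.pos_of_ne_zero (by
        have : 0 < s := by omega
        positivity)
      omega
    calc _ ≤ 5 * s * (2 * (A * (2 * s) ^ 2)) * (2 * s) := by gcongr
      _ = 80 * A * s ^ 4 := by ring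
  calc C * ((4 * I.size + 1) * (A * (I.n + 1) ^ 2 + 1) * (T.numNodes + 1)) ^ C
      ≤ C * (80 * A * s ^ 4) ^ C := by gcongr
    _ = C * 80 ^ C * I.k ^ (2 * C * T.width) * 2 ^ (C * I.m) * s ^ (4 * C) := by
        rw [hA, mul_pow, mul_pow, mul_pow, ← pow_mul, ← pow_mul, ← pow_mul]
        ring_nf
    _ ≤ _ := by
        gcongr
        any_goals omega
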